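/- Let $\mathbb{G}_2$ be the category generated by $s_1,t_1:0\rightrightarrows 1$ and $s_2,t_2:1\rightrightarrows 2$ subject to $s_2s_1=t_2s_1$ and $t_2t_1=s_2t_1$, and let $2\text{-}\mathrm{Glob}=[\mathbb{G}_2^{op},\mathrm{Set}]$ be the category of 2-globular sets. Let $T$ be the free strict 2-category monad on $2\text{-}\mathrm{Glob}$, i.e. the monad induced by the adjunction between 2-globular sets and (small) strict 2-categories with strict 2-functors. The objects of $TX$ are the 0-cells of $X$, its 1-cells are the finite paths of 1-cells of $X$, and its 2-cells are the finite horizontal paths of (possibly empty) vertical paths of 2-cells of $X$. A 2-pasting diagram is a finite (possibly empty) sequence $P=(P_1,\dots,P_k)$ of natural numbers (a sequence of 1-pasting diagrams, $P_i$ being a chain of $P_i$ arrows). A morphism $P\to Q=(Q_1,\dots,Q_l)$ in $\mathrm{pd}(2)$ consists of a distance-preserving map (translation) $\{0,\dots,k\}\to\{0,\dots,l\}$, $x\mapsto a+x$, and, for each $1\le i\le k$, a distance-preserving map $\{0,\dots,P_i\}\to\{0,\dots,Q_{a+i}\}$. The functor $i_1:\mathrm{pd}(2)\to 2\text{-}\mathrm{Glob}$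 sends $P$ to the 2-globular set with 0-cells $0,\dots,k$, with $P_i+1$ parallel 1-cells from $i-1$ to $i$ for each $1\le i\le k$, and with one 2-cell from each of these 1-cells to the next one; it sends a morphism to the evident map of cells. Then $T$ is a monad with arities $i_1$, that is: 1. $i_1$ is fully faithful and dense; 2. $T$, with the identity 2-cell, is a left Kan extension of $T\circ i_1$ along $i_1$; 3. this left Kan extension is preserved by the nerve functor $2\text{-}\mathrm{Glob}(i_1,1):2\text{-}\mathrm{Glob}\to[\mathrm{pd}(2)^{op},\mathrm{Set}]$. Moreover, for every 2-pasting diagram $P$, every 2-globular set $X$ and every morphism $g:i_1P\to TX$ there are a 2-pasting diagram $F$ and morphisms $e:i_1P\to Ti_1F$ and $f:i_1F\to X$ with $g=Tf\circ e$, and this factorization is unique up to zig-zag: any two factorizations $(F,e,f)$, $(F',e',f')$ of $g$ are identified by the equivalence relation generated by relating $(F_1,e_1,f_1)$ to $(F_2,e_2,f_2)$ whenever there is $u:F_1\to F_2$ in $\mathrm{pd}(2)$ with $Ti_1u\circ e_1=e_2$ and $f_2\circ i_1u=f_1$. -/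

import Mathlib

open CategoryTheory

universe u v w w'

namespace TwoArities

/-! ## 2-globular sets -/

/-- The objects of the category `𝔾₂`. -/
inductive Globe2 : Type
  | d0 | d1 | d2

namespace Globe2

/-- The morphisms of `𝔾₂`. Besides the identities and the generators `s₁, t₁ : 0 ⟶ 1` and
`s₂, t₂ : 1 ⟶ 2` there are exactly two composites `0 ⟶ 2`, namely
`s₁₂ = s₂ ∘ s₁ = t₂ ∘ s₁` and `t₁₂ = t₂ ∘ t₁ = s₂ ∘ t₁`. -/
inductive Hom : Globe2 → Globe2 → Type
  | id (a : Globe2) : Hom a a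
  | s₁ : Hom d0 d1
  | t₁ : Hom d0 d1
  | s₂ : Hom d1 d2
  | t₂ : Hom d1 d2
  | s₁₂ : Hom d0 d2
  | t₁₂ : Hom d0 d2

/-- Composition in `𝔾₂`, in diagrammatic order. -/
def Hom.comp : {a b c : Globe2} → Hom a b → Hom b c → Hom a c
  | _, _, _, .id _, g => g
  | _, _, _, f, .id _ => f
  | _, _, _, .s₁, .s₂ => .s₁₂
  | _, _, _, .s₁, .t₂ => .s₁₂
  | _, _, _, .t₁, .s₂ => .t₁₂
  | _, _, _, .t₁, .t₂ => .t₁₂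

instance : SmallCategory Globe2 where
  Hom := Hom
  id := Hom.id
  comp := Hom.comp
  id_comp f := by cases f <;> rfl
  comp_id f := by cases f <;> rfl
  assoc f g h := by cases f <;> cases g <;> cases h <;> rfl

end Globe2

/-- The category of 2-globular sets: presheaves on `𝔾₂`. -/
abbrev TwoGlob : Type (u + 1) := Globe2ᵒᵖ ⥤ Type u

namespace TwoGlob

/-- The set of 0-cells. -/
abbrev C0 (X : TwoGlob.{u}) : Type u := X.obj (Opposite.op Globe2.d0)
/-- The set of 1-cells. -/
abbrev C1 (X : TwoGlob.{u}) : Type u := X.obj (Opposite.op Globe2.d1)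
/-- The set of 2-cells. -/
abbrev C2 (X : TwoGlob.{u}) : Type u := X.obj (Opposite.op Globe2.d2)

/-- The source of a 1-cell. -/
def s₁ (X : TwoGlob.{u}) : X.C1 → X.C0 :=
  X.map (Quiver.Hom.op (V := Globe2) Globe2.Hom.s₁)
/-- The target of a 1-cell. -/
def t₁ (X : TwoGlob.{u}) : X.C1 → X.C0 :=
  X.map (Quiver.Hom.op (V := Globe2) Globe2.Hom.t₁)
/-- The source of a 2-cell. -/
def s₂ (X : TwoGlob.{u}) : X.C2 → X.C1 :=
  X.map (Quiver.Hom.op (V := Globe2) Globe2.Hom.s₂)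
/-- The target of a 2-cell. -/
def t₂ (X : TwoGlob.{u}) : X.C2 → X.C1 :=
  X.map (Quiver.Hom.op (V := Globe2) Globe2.Hom.t₂)

theorem s₁_s₂ (X : TwoGlob.{u}) (x : X.C2) :
    X.s₁ (X.s₂ x) = X.map (Quiver.Hom.op (V := Globe2) Globe2.Hom.s₁₂) x :=
  (Functor.map_comp_apply X (Quiver.Hom.op (V := Globe2) Globe2.Hom.s₂)
    (Quiver.Hom.op (V := Globe2) Globe2.Hom.s₁) x).symm

theorem t₁_t₂ (X : TwoGlob.{u}) (x : X.C2) :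
    X.t₁ (X.t₂ x) = X.map (Quiver.Hom.op (V := Globe2) Globe2.Hom.t₁₂) x :=
  (Functor.map_comp_apply X (Quiver.Hom.op (V := Globe2) Globe2.Hom.t₂)
    (Quiver.Hom.op (V := Globe2) Globe2.Hom.t₁) x).symm

theorem s₁_t₂ (X : TwoGlob.{u}) (x : X.C2) : X.s₁ (X.t₂ x) = X.s₁ (X.s₂ x) :=
  ((Functor.map_comp_apply X (Quiver.Hom.op (V := Globe2) Globe2.Hom.t₂)
    (Quiver.Hom.op (V := Globe2) Globe2.Hom.s₁) x).symm).trans (X.s₁_s₂ x).symm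

theorem t₁_s₂ (X : TwoGlob.{u}) (x : X.C2) : X.t₁ (X.s₂ x) = X.t₁ (X.t₂ x) :=
  ((Functor.map_comp_apply X (Quiver.Hom.op (V := Globe2) Globe2.Hom.s₂)
    (Quiver.Hom.op (V := Globe2) Globe2.Hom.t₁) x).symm).trans (X.t₁_t₂ x).symm

/-- The underlying family of sets of a 2-globular set given by its cells. -/
def cells (A₀ A₁ A₂ : Type u) : Globe2 → Type u
  | .d0 => A₀
  | .d1 => A₁
  | .d2 => A₂

/-- The 2-globular set with given cells, sources and targets. -/
def mk {A₀ A₁ A₂ : Type u} (s t : A₁ → A₀) (σ τ : A₂ → A₁)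
    (hs : ∀ x, s (τ x) = s (σ x)) (ht : ∀ x, t (σ x) = t (τ x)) : TwoGlob.{u} where
  obj d := cells A₀ A₁ A₂ d.unop
  map {d e} f := TypeCat.ofHom
    (match e, d, f with
      | ⟨_⟩, ⟨_⟩, ⟨.id _⟩ => fun x => x
      | ⟨_⟩, ⟨_⟩, ⟨.s₁⟩ => s
      | ⟨_⟩, ⟨_⟩, ⟨.t₁⟩ => t
      | ⟨_⟩, ⟨_⟩, ⟨.s₂⟩ => σ
      | ⟨_⟩, ⟨_⟩, ⟨.t₂⟩ => τ
      | ⟨_⟩, ⟨_⟩, ⟨.s₁₂⟩ => fun x => s (σ x)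
      | ⟨_⟩, ⟨_⟩, ⟨.t₁₂⟩ => fun x => t (τ x))
  map_id d := rfl
  map_comp {a b c} f g := by
    obtain ⟨a⟩ := a
    obtain ⟨b⟩ := b
    obtain ⟨c⟩ := c
    obtain ⟨f⟩ := f
    obtain ⟨g⟩ := g
    change Globe2.Hom b a at f
    change Globe2.Hom c b at g
    cases f <;> cases g <;> first
      | rfl
      | (ext x; exact (hs x).symm)
      | (ext x; exact (ht x).symm)

variable {X Y : TwoGlob.{u}}

/-- The action of a morphism on 0-cells. -/
def map0 (φ : X ⟶ Y) : X.C0 → Y.C0 := φ.app (Opposite.op Globe2.d0)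
/-- The action of a morphism on 1-cells. -/
def map1 (φ : X ⟶ Y) : X.C1 → Y.C1 := φ.app (Opposite.op Globe2.d1)
/-- The action of a morphism on 2-cells. -/
def map2 (φ : X ⟶ Y) : X.C2 → Y.C2 := φ.app (Opposite.op Globe2.d2)

theorem s₁_map (φ : X ⟶ Y) (x : X.C1) : Y.s₁ (map1 φ x) = map0 φ (X.s₁ x) :=
  (NatTrans.naturality_apply φ (Quiver.Hom.op (V := Globe2) Globe2.Hom.s₁) x).symm
theorem t₁_map (φ : X ⟶ Y) (x : X.C1) : Y.t₁ (map1 φ x) = map0 φ (X.t₁ x) :=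
  (NatTrans.naturality_apply φ (Quiver.Hom.op (V := Globe2) Globe2.Hom.t₁) x).symm
theorem s₂_map (φ : X ⟶ Y) (x : X.C2) : Y.s₂ (map2 φ x) = map1 φ (X.s₂ x) :=
  (NatTrans.naturality_apply φ (Quiver.Hom.op (V := Globe2) Globe2.Hom.s₂) x).symm
theorem t₂_map (φ : X ⟶ Y) (x : X.C2) : Y.t₂ (map2 φ x) = map1 φ (X.t₂ x) :=
  (NatTrans.naturality_apply φ (Quiver.Hom.op (V := Globe2) Globe2.Hom.t₂) x).symm

/-- A morphism of 2-globular sets given by its action on cells. -/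
def homMk (f₀ : X.C0 → Y.C0) (f₁ : X.C1 → Y.C1) (f₂ : X.C2 → Y.C2)
    (hs₁ : ∀ x, Y.s₁ (f₁ x) = f₀ (X.s₁ x)) (ht₁ : ∀ x, Y.t₁ (f₁ x) = f₀ (X.t₁ x))
    (hs₂ : ∀ x, Y.s₂ (f₂ x) = f₁ (X.s₂ x)) (ht₂ : ∀ x, Y.t₂ (f₂ x) = f₁ (X.t₂ x)) :
    X ⟶ Y where
  app d := TypeCat.ofHom
    (match d with
      | ⟨.d0⟩ => f₀
      | ⟨.d1⟩ => f₁
      | ⟨.d2⟩ => f₂)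
  naturality {a b} f := by
    obtain ⟨a⟩ := a
    obtain ⟨b⟩ := b
    obtain ⟨f⟩ := f
    change Globe2.Hom b a at f
    cases f
    case id =>
      change X.map (𝟙 _) ≫ _ = _ ≫ Y.map (𝟙 _)
      rw [X.map_id, Y.map_id, Category.id_comp, Category.comp_id]
    case s₁ => ext x; exact (hs₁ x).symm
    case t₁ => ext x; exact (ht₁ x).symm
    case s₂ => ext x; exact (hs₂ x).symm
    case t₂ => ext x; exact (ht₂ x).symm
    case s₁₂ =>
      ext x
      refine (congrArg f₀ (X.s₁_s₂ x)).symm.trans (Eq.trans ?_ (Y.s₁_s₂ (f₂ x)))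
      rw [hs₂, hs₁]
    case t₁₂ =>
      ext x
      refine (congrArg f₀ (X.t₁_t₂ x)).symm.trans (Eq.trans ?_ (Y.t₁_t₂ (f₂ x)))
      rw [ht₂, ht₁]

theorem hom_ext {φ ψ : X ⟶ Y} (h₀ : ∀ x, map0 φ x = map0 ψ x) (h₁ : ∀ x, map1 φ x = map1 ψ x)
    (h₂ : ∀ x, map2 φ x = map2 ψ x) : φ = ψ := by
  ext d x
  obtain ⟨d⟩ := d
  cases d
  · exact h₀ x
  · exact h₁ x
  · exact h₂ x

end TwoGlob

/-! ## Strict 2-categories -/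

/-- A category structure on a graph `s, t : A → V`: identities and an associative and unital
composition `comp f g` (in diagrammatic order) of the pairs with `t f = s g`. -/
structure CatStr {V : Type v} {A : Type w} (s t : A → V) where
  id : V → A
  comp : (f g : A) → t f = s g → A
  s_id : ∀ a, s (id a) = a
  t_id : ∀ a, t (id a) = a
  s_comp : ∀ f g h, s (comp f g h) = s f
  t_comp : ∀ f g h, t (comp f g h) = t g
  id_comp : ∀ f h, comp (id (s f)) f h = f
  comp_id : ∀ f h, comp f (id (t f)) h = f
  assoc : ∀ f g k (h₁ : t f = s g) (h₂ : t g = s k) h₃ h₄,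
    comp (comp f g h₁) k h₃ = comp f (comp g k h₂) h₄

/-- A (small) strict 2-category: a 2-globular set with composition of 1-cells (`cat1`), vertical
composition of 2-cells (`vert`) and horizontal composition of 2-cells (`horiz`), each of them
making up a category, such that sources, targets and identities are functorial and the interchange
law holds. The proofs of composability which are arguments of a composition are quantified
over; those that are consequences of the other ones are always available. -/
structure StrictTwoCat : Type (u + 1) where
  glob : TwoGlob.{u}
  cat1 : CatStr glob.s₁ glob.t₁
  vert : CatStr glob.s₂ glob.t₂
  horiz : CatStr (fun α => glob.s₁ (glob.s₂ α)) (fun α => glob.t₁ (glob.t₂ α))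
  s_horiz : ∀ α β h h', glob.s₂ (horiz.comp α β h) = cat1.comp (glob.s₂ α) (glob.s₂ β) h'
  t_horiz : ∀ α β h h', glob.t₂ (horiz.comp α β h) = cat1.comp (glob.t₂ α) (glob.t₂ β) h'
  id_id : ∀ a, horiz.id a = vert.id (cat1.id a)
  id_comp : ∀ f g h h', vert.id (cat1.comp f g h) = horiz.comp (vert.id f) (vert.id g) h'
  interchange : ∀ α α' β β' (hα : glob.t₂ α = glob.s₂ α') (hβ : glob.t₂ β = glob.s₂ β') h h' h₁ h₂,
    vert.comp (horiz.comp α β h) (horiz.comp α' β' h') h₁ =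
      horiz.comp (vert.comp α α' hα) (vert.comp β β' hβ) h₂

namespace StrictTwoCat

/-- A strict 2-functor: a morphism of 2-globular sets that preserves all identities and
compositions (horizontal identities are vertical identities of identities). -/
@[ext]
structure Hom (C D : StrictTwoCat.{u}) where
  toGlob : C.glob ⟶ D.glob
  map_id₁ : ∀ a, TwoGlob.map1 toGlob (C.cat1.id a) = D.cat1.id (TwoGlob.map0 toGlob a)
  map_comp₁ : ∀ f g h h', TwoGlob.map1 toGlob (C.cat1.comp f g h) =
    D.cat1.comp (TwoGlob.map1 toGlob f) (TwoGlob.map1 toGlob g) h'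
  map_id₂ : ∀ f, TwoGlob.map2 toGlob (C.vert.id f) = D.vert.id (TwoGlob.map1 toGlob f)
  map_vert : ∀ α β h h', TwoGlob.map2 toGlob (C.vert.comp α β h) =
    D.vert.comp (TwoGlob.map2 toGlob α) (TwoGlob.map2 toGlob β) h'
  map_horiz : ∀ α β h h', TwoGlob.map2 toGlob (C.horiz.comp α β h) =
    D.horiz.comp (TwoGlob.map2 toGlob α) (TwoGlob.map2 toGlob β) h'

/-- The category of strict 2-categories and strict 2-functors. -/
instance : LargeCategory StrictTwoCat.{u} where
  Hom := Hom
  id C :=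
    { toGlob := 𝟙 C.glob
      map_id₁ := fun _ => rfl
      map_comp₁ := fun _ _ _ _ => rfl
      map_id₂ := fun _ => rfl
      map_vert := fun _ _ _ _ => rfl
      map_horiz := fun _ _ _ _ => rfl }
  comp {C D E} F G :=
    { toGlob := F.toGlob ≫ G.toGlob
      map_id₁ := fun a => by
        change TwoGlob.map1 G.toGlob (TwoGlob.map1 F.toGlob _) = _
        rw [F.map_id₁, G.map_id₁]; rfl
      map_comp₁ := fun f g h h' => by
        have e : D.glob.t₁ (TwoGlob.map1 F.toGlob f) = D.glob.s₁ (TwoGlob.map1 F.toGlob g) := by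
          rw [TwoGlob.t₁_map, TwoGlob.s₁_map, h]
        change TwoGlob.map1 G.toGlob (TwoGlob.map1 F.toGlob _) = _
        rw [F.map_comp₁ f g h e, G.map_comp₁ _ _ e h']; rfl
      map_id₂ := fun a => by
        change TwoGlob.map2 G.toGlob (TwoGlob.map2 F.toGlob _) = _
        rw [F.map_id₂, G.map_id₂]; rfl
      map_vert := fun f g h h' => by
        have e : D.glob.t₂ (TwoGlob.map2 F.toGlob f) = D.glob.s₂ (TwoGlob.map2 F.toGlob g) := by
          rw [TwoGlob.t₂_map, TwoGlob.s₂_map, h]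
        change TwoGlob.map2 G.toGlob (TwoGlob.map2 F.toGlob _) = _
        rw [F.map_vert f g h e, G.map_vert _ _ e h']; rfl
      map_horiz := fun f g h h' => by
        have e : D.glob.t₁ (D.glob.t₂ (TwoGlob.map2 F.toGlob f)) =
            D.glob.s₁ (D.glob.s₂ (TwoGlob.map2 F.toGlob g)) := by
          rw [TwoGlob.t₂_map, TwoGlob.s₂_map, TwoGlob.t₁_map, TwoGlob.s₁_map, h]
        change TwoGlob.map2 G.toGlob (TwoGlob.map2 F.toGlob _) = _
        rw [F.map_horiz f g h e, G.map_horiz _ _ e h']; rfl }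

/-- The forgetful functor from strict 2-categories to 2-globular sets. -/
def forget : StrictTwoCat.{u} ⥤ TwoGlob.{u} where
  obj C := C.glob
  map F := F.toGlob

end StrictTwoCat

/-! ## Paths in a graph -/

/-- `IsPath s t a l b`: the list `l` of edges is a path from `a` to `b` in the graph `s, t`. -/
def IsPath {V : Type v} {E : Type w} (s t : E → V) : V → List E → V → Prop
  | a, [], b => a = b
  | a, e :: l, b => s e = a ∧ IsPath s t (t e) l b

/-- Finite paths in a graph; the empty path at every vertex is included. -/
@[ext]
structure GPath {V : Type v} {E : Type w} (s t : E → V) where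
  src : V
  tgt : V
  edges : List E
  isPath : IsPath s t src edges tgt

section Paths

variable {V : Type v} {E : Type w} {s t : E → V}

theorem IsPath.tgt_eq {l : List E} {a b b' : V} (h : IsPath s t a l b) (h' : IsPath s t a l b') :
    b = b' := by
  induction l generalizing a with
  | nil => exact h.symm.trans h'
  | cons e l ih => exact ih h.2 h'.2

theorem IsPath.append {l l' : List E} {a b c : V} (h : IsPath s t a l b)
    (h' : IsPath s t b l' c) : IsPath s t a (l ++ l') c := by
  induction l generalizing a with
  | nil => cases h; exact h'
  | cons e l ih => exact ⟨h.1, ih h.2⟩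

theorem GPath.ext_edges {p q : GPath s t} (h : p.src = q.src) (h' : p.edges = q.edges) :
    p = q := by
  refine GPath.ext h ?_ h'
  have := q.isPath
  rw [← h, ← h'] at this
  exact p.isPath.tgt_eq this

/-- The empty path. -/
def GPath.nil (s t : E → V) (a : V) : GPath s t := ⟨a, a, [], rfl⟩

/-- The path of length one. -/
def GPath.single (s t : E → V) (e : E) : GPath s t := ⟨s e, t e, [e], rfl, rfl⟩

/-- Concatenation of paths. -/
def GPath.comp (p q : GPath s t) (h : p.tgt = q.src) : GPath s t :=
  ⟨p.src, q.tgt, p.edges ++ q.edges, p.isPath.append (h ▸ q.isPath)⟩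

/-- The free category on a graph: paths and concatenation. -/
def pathCat (s t : E → V) : CatStr (V := V) (A := GPath s t) GPath.src GPath.tgt where
  id := GPath.nil s t
  comp := GPath.comp
  s_id _ := rfl
  t_id _ := rfl
  s_comp _ _ _ := rfl
  t_comp _ _ _ := rfl
  id_comp _ _ := rfl
  comp_id _ _ := GPath.ext_edges rfl (List.append_nil _)
  assoc _ _ _ _ _ _ _ := GPath.ext_edges rfl (List.append_assoc _ _ _)

variable {V' : Type v} {E' : Type w'} {s' t' : E' → V'}

theorem IsPath.map {f : V → V'} {g : E → E'} (hs : ∀ e, s' (g e) = f (s e))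
    (ht : ∀ e, t' (g e) = f (t e)) {l : List E} {a b : V} (h : IsPath s t a l b) :
    IsPath s' t' (f a) (l.map g) (f b) := by
  induction l generalizing a with
  | nil => exact congrArg f h
  | cons e l ih =>
    refine ⟨(hs e).trans (congrArg f h.1), ?_⟩
    rw [ht]
    exact ih h.2

/-- The image of a path under a morphism of graphs. -/
def GPath.map (f : V → V') (g : E → E') (hs : ∀ e, s' (g e) = f (s e))
    (ht : ∀ e, t' (g e) = f (t e)) (p : GPath s t) : GPath s' t' :=
  ⟨f p.src, f p.tgt, p.edges.map g, p.isPath.map hs ht⟩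

namespace CatStr

variable (K : CatStr s' t') (f : V → V') (g : E → E') (hs : ∀ e, s' (g e) = f (s e))
  (ht : ∀ e, t' (g e) = f (t e))

/-- The composite of the image of a path in a category. -/
def foldAux : (l : List E) → (a b : V) → IsPath s t a l b →
    {c : E' // s' c = f a ∧ t' c = f b}
  | [], a, _, h => ⟨K.id (f a), K.s_id _, (K.t_id _).trans (congrArg f h)⟩
  | e :: l, _, b, h =>
    let r := foldAux l (t e) b h.2
    ⟨K.comp (g e) r.1 ((ht e).trans r.2.1.symm),
      (K.s_comp _ _ _).trans ((hs e).trans (congrArg f h.1)), (K.t_comp _ _ _).trans r.2.2⟩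

/-- The extension of a morphism of graphs to the free category. -/
def fold (p : GPath s t) : E' := (foldAux K f g hs ht p.edges p.src p.tgt p.isPath).1

theorem s_fold (p : GPath s t) : s' (K.fold f g hs ht p) = f p.src :=
  (foldAux K f g hs ht p.edges p.src p.tgt p.isPath).2.1

theorem t_fold (p : GPath s t) : t' (K.fold f g hs ht p) = f p.tgt :=
  (foldAux K f g hs ht p.edges p.src p.tgt p.isPath).2.2

theorem fold_nil (a : V) : K.fold f g hs ht (GPath.nil s t a) = K.id (f a) := rfl

theorem comp_congr {x x' y y' : E'} (hx : x = x') (hy : y = y') (h : t' x = s' y)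
    (h' : t' x' = s' y') : K.comp x y h = K.comp x' y' h' := by
  subst hx; subst hy; rfl

theorem comp_id_of_eq (x : E') (a : V') (e : t' x = a) (h) : K.comp x (K.id a) h = x := by
  subst e; exact K.comp_id x h

theorem id_comp_of_eq (x : E') (a : V') (e : s' x = a) (h) : K.comp (K.id a) x h = x := by
  subst e; exact K.id_comp x h

theorem fold_single (e : E) : K.fold f g hs ht (GPath.single s t e) = g e :=
  K.comp_id_of_eq (g e) (f (t e)) (ht e) _

theorem foldAux_append (l l' : List E) (a b c : V) (h : IsPath s t a l b) (h' : IsPath s t b l' c)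
    (hh : IsPath s t a (l ++ l') c) (e) :
    (K.foldAux f g hs ht (l ++ l') a c hh).1 =
      K.comp (K.foldAux f g hs ht l a b h).1 (K.foldAux f g hs ht l' b c h').1 e := by
  induction l generalizing a with
  | nil =>
    cases h
    exact (K.id_comp_of_eq _ _ (K.foldAux f g hs ht l' b c h').2.1 _).symm
  | cons x l ih =>
    have e' : t' (K.foldAux f g hs ht l (t x) b h.2).1 = s' (K.foldAux f g hs ht l' b c h').1 :=
      (K.foldAux f g hs ht l (t x) b h.2).2.2.trans (K.foldAux f g hs ht l' b c h').2.1.symm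
    refine Eq.trans (K.comp_congr rfl (ih (t x) h.2 hh.2 e') _ ?_)
      (K.assoc _ _ _ _ _ _ _).symm
    rw [K.s_comp]
    exact (ht x).trans (K.foldAux f g hs ht l (t x) b h.2).2.1.symm

theorem fold_comp (p q : GPath s t) (h) (h') : K.fold f g hs ht (p.comp q h) =
    K.comp (K.fold f g hs ht p) (K.fold f g hs ht q) h' := by
  obtain ⟨a, b, l, hl⟩ := p
  obtain ⟨b', c, l', hl'⟩ := q
  cases h
  exact K.foldAux_append f g hs ht l l' a b c hl hl' _ h'

/-- The extension to the free category is unique. -/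
theorem eq_fold (F : GPath s t → E') (hF : ∀ p q h h', F (p.comp q h) = K.comp (F p) (F q) h')
    (hnil : ∀ a, F (GPath.nil s t a) = K.id (f a))
    (hsingle : ∀ e, F (GPath.single s t e) = g e) (p : GPath s t) :
    F p = K.fold f g hs ht p := by
  obtain ⟨a, b, l, hl⟩ := p
  induction l generalizing a with
  | nil => cases hl; exact hnil b
  | cons e l ih =>
    obtain ⟨rfl, hl⟩ := hl
    have key : F ⟨t e, b, l, hl⟩ = K.fold f g hs ht ⟨t e, b, l, hl⟩ := ih (t e) hl
    have h' : t' (F (GPath.single s t e)) = s' (F ⟨t e, b, l, hl⟩) := by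
      rw [hsingle, key, ht]
      exact (K.s_fold f g hs ht ⟨t e, b, l, hl⟩).symm
    exact (hF (GPath.single s t e) ⟨t e, b, l, hl⟩ rfl h').trans
      (K.comp_congr (hsingle e) key _ _)

end CatStr

end Paths

/-! ## The free strict 2-category on a 2-globular set -/

namespace Free

variable (X : TwoGlob.{u})

/-- The 1-cells of the free 2-category: paths of 1-cells of `X`. -/
abbrev Cell1 : Type u := GPath X.s₁ X.t₁

/-- Vertical paths of 2-cells of `X` (possibly empty, in which case they are just a 1-cell). -/
abbrev Column : Type u := GPath X.s₂ X.t₂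

variable {X} in
theorem Column.s_aux {l : List X.C2} {f g : X.C1} (h : IsPath X.s₂ X.t₂ f l g) :
    X.s₁ g = X.s₁ f ∧ X.t₁ g = X.t₁ f := by
  induction l generalizing f with
  | nil => cases h; exact ⟨rfl, rfl⟩
  | cons x l ih =>
    obtain ⟨rfl, h⟩ := h
    rw [(ih h).1, (ih h).2, X.s₁_t₂, X.t₁_s₂]
    exact ⟨rfl, rfl⟩

variable {X} in
theorem Column.s_tgt (c : Column X) : X.s₁ c.tgt = X.s₁ c.src := (Column.s_aux c.isPath).1

variable {X} in
theorem Column.t_tgt (c : Column X) : X.t₁ c.src = X.t₁ c.tgt := (Column.s_aux c.isPath).2.symm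

/-- The 2-cells of the free 2-category: horizontal paths of vertical paths. -/
abbrev Cell2 : Type u := GPath (fun c : Column X => X.s₁ c.src) (fun c : Column X => X.t₁ c.tgt)

variable {X}

/-- The source of a 2-cell. -/
def src2 (α : Cell2 X) : Cell1 X :=
  α.map id GPath.src (fun _ => rfl) (fun c => Column.t_tgt c)

/-- The target of a 2-cell. -/
def tgt2 (α : Cell2 X) : Cell1 X :=
  α.map id GPath.tgt (fun c => Column.s_tgt c) (fun _ => rfl)

variable (X) in
/-- The underlying 2-globular set of the free 2-category. -/
def glob : TwoGlob.{u} :=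
  TwoGlob.mk (A₀ := X.C0) (A₁ := Cell1 X) (A₂ := Cell2 X) GPath.src GPath.tgt src2 tgt2
    (fun _ => rfl) (fun _ => rfl)

/-- The identity 2-cell of a path of 1-cells. -/
def id2 (p : Cell1 X) : Cell2 X :=
  p.map id (GPath.nil X.s₂ X.t₂) (fun _ => rfl) (fun _ => rfl)

/-- Vertical composition: concatenate the vertical paths column by column. -/
def vlist : (l l' : List (Column X)) → l.map GPath.tgt = l'.map GPath.src → List (Column X)
  | [], [], _ => []
  | c :: l, d :: l', h =>
    c.comp d (List.cons.inj h).1 :: vlist l l' (List.cons.inj h).2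

theorem vlist_map_src (l l' : List (Column X)) (h) :
    (vlist l l' h).map GPath.src = l.map GPath.src := by
  induction l generalizing l' with
  | nil =>
    cases l' with
    | nil => rfl
    | cons d l' => cases h
  | cons c l ih =>
    cases l' with
    | nil => cases h
    | cons d l' => exact congrArg (c.src :: ·) (ih l' _)

theorem vlist_map_tgt (l l' : List (Column X)) (h) :
    (vlist l l' h).map GPath.tgt = l'.map GPath.tgt := by
  induction l generalizing l' with
  | nil =>
    cases l' with
    | nil => rfl
    | cons d l' => cases h
  | cons c l ih =>
    cases l' with
    | nil => cases h
    | cons d l' => exact congrArg (d.tgt :: ·) (ih l' _)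

theorem vlist_isPath (l l' : List (Column X)) (h) (a b : X.C0)
    (hl : IsPath (fun c : Column X => X.s₁ c.src) (fun c : Column X => X.t₁ c.tgt) a l b) :
    IsPath (fun c : Column X => X.s₁ c.src) (fun c : Column X => X.t₁ c.tgt) a
      (vlist l l' h) b := by
  induction l generalizing l' a with
  | nil =>
    cases l' with
    | nil => exact hl
    | cons d l' => cases h
  | cons c l ih =>
    cases l' with
    | nil => cases h
    | cons d l' =>
      refine ⟨hl.1, ?_⟩
      have e : X.t₁ (c.comp d (List.cons.inj h).1).tgt = X.t₁ c.tgt := by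
        rw [← Column.t_tgt, ← Column.t_tgt]; rfl
      have := ih l' (List.cons.inj h).2 (X.t₁ c.tgt) hl.2
      rw [← e] at this
      exact this

/-- Vertical composition of 2-cells. -/
def vcomp (α β : Cell2 X) (h : tgt2 α = src2 β) : Cell2 X :=
  ⟨α.src, α.tgt, vlist α.edges β.edges (congrArg GPath.edges h),
    vlist_isPath _ _ _ _ _ α.isPath⟩

theorem id_vlist (l l' : List (Column X)) (h)
    (hl : l = (l'.map GPath.src).map (GPath.nil X.s₂ X.t₂)) : vlist l l' h = l' := by
  subst hl
  induction l' with
  | nil => rfl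
  | cons d l' ih =>
    exact congrArg₂ List.cons (GPath.ext_edges rfl rfl) (ih _)

theorem vlist_id (l l' : List (Column X)) (h)
    (hl : l' = (l.map GPath.tgt).map (GPath.nil X.s₂ X.t₂)) : vlist l l' h = l := by
  subst hl
  induction l with
  | nil => rfl
  | cons d l ih =>
    exact congrArg₂ List.cons (GPath.ext_edges rfl (List.append_nil _)) (ih _)

theorem vlist_assoc (l m n : List (Column X)) (h₁ h₂ h₃ h₄) :
    vlist (vlist l m h₁) n h₃ = vlist l (vlist m n h₂) h₄ := by
  induction l generalizing m n with
  | nil =>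
    cases m with
    | nil =>
      cases n with
      | nil => rfl
      | cons _ _ => cases h₂
    | cons _ _ => cases h₁
  | cons c l ih =>
    cases m with
    | nil => cases h₁
    | cons d m =>
      cases n with
      | nil => cases h₂
      | cons e n =>
        exact congrArg₂ List.cons (GPath.ext_edges rfl (List.append_assoc _ _ _)) (ih m n _ _ _ _)

theorem vlist_append (l l' m m' : List (Column X)) (h h' hh) :
    vlist (l ++ m) (l' ++ m') hh = vlist l l' h ++ vlist m m' h' := by
  induction l generalizing l' with
  | nil =>
    cases l' with
    | nil => rfl
    | cons _ _ => cases h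
  | cons c l ih =>
    cases l' with
    | nil => cases h
    | cons d l' => exact congrArg (c.comp d _ :: ·) (ih l' _ _)

theorem map_map_nil (l : List X.C1) (g : Column X → X.C1)
    (hg : ∀ f, g (GPath.nil X.s₂ X.t₂ f) = f) : (l.map (GPath.nil X.s₂ X.t₂)).map g = l := by
  rw [List.map_map, show g ∘ GPath.nil X.s₂ X.t₂ = id from funext hg, List.map_id]

variable (X) in
/-- The free strict 2-category on a 2-globular set. -/
def twoCat : StrictTwoCat.{u} where
  glob := glob X
  cat1 := pathCat X.s₁ X.t₁
  vert :=
    { id := id2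
      comp := vcomp
      s_id := fun _ => GPath.ext_edges rfl (map_map_nil _ _ fun _ => rfl)
      t_id := fun _ => GPath.ext_edges rfl (map_map_nil _ _ fun _ => rfl)
      s_comp := fun α β h => GPath.ext_edges rfl (vlist_map_src _ _ _)
      t_comp := fun α β h => by
        have h' : tgt2 α = src2 β := h
        have e : (tgt2 α).src = (src2 β).src := congrArg (fun p : Cell1 X => p.src) h'
        exact GPath.ext_edges (p := tgt2 (vcomp α β h)) (q := tgt2 β)
          e (vlist_map_tgt _ _ _)
      id_comp := fun α h => GPath.ext_edges rfl (id_vlist _ _ _ rfl)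
      comp_id := fun α h => GPath.ext_edges rfl (vlist_id _ _ _ rfl)
      assoc := fun α β γ _ _ _ _ => GPath.ext_edges rfl (vlist_assoc _ _ _ _ _ _ _) }
  horiz := pathCat (fun c : Column X => X.s₁ c.src) (fun c : Column X => X.t₁ c.tgt)
  s_horiz α β h h' := GPath.ext_edges rfl List.map_append
  t_horiz α β h h' := GPath.ext_edges rfl List.map_append
  id_id a := rfl
  id_comp f g h h' := GPath.ext_edges rfl List.map_append
  interchange α α' β β' hα hβ h h' h₁ h₂ :=
    GPath.ext_edges rfl (vlist_append _ _ _ _ _ _ _)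

variable (X) in
/-- The inclusion of a 2-globular set in its free 2-category: every cell is sent to the
corresponding path of length one. -/
def incl : X ⟶ (twoCat X).glob :=
  TwoGlob.homMk (Y := glob X) (fun x => x) (GPath.single X.s₁ X.t₁)
    (fun x => GPath.single (fun c : Column X => X.s₁ c.src) (fun c : Column X => X.t₁ c.tgt)
      (GPath.single X.s₂ X.t₂ x))
    (fun _ => rfl) (fun _ => rfl) (fun x => GPath.ext_edges rfl rfl)
    (fun x => GPath.ext_edges (X.s₁_t₂ x).symm rfl)

section Lift

variable {C : StrictTwoCat.{u}} (φ : X ⟶ C.glob)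

/-- The extension of `φ` on 1-cells. -/
def lift1 : Cell1 X → C.glob.C1 :=
  C.cat1.fold (TwoGlob.map0 φ) (TwoGlob.map1 φ) (TwoGlob.s₁_map φ) (TwoGlob.t₁_map φ)

/-- The extension of `φ` on vertical paths. -/
def liftCol : Column X → C.glob.C2 :=
  C.vert.fold (TwoGlob.map1 φ) (TwoGlob.map2 φ) (TwoGlob.s₂_map φ) (TwoGlob.t₂_map φ)

theorem s_liftCol (c : Column X) : C.glob.s₂ (liftCol φ c) = TwoGlob.map1 φ c.src :=
  C.vert.s_fold _ _ _ _ c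

theorem t_liftCol (c : Column X) : C.glob.t₂ (liftCol φ c) = TwoGlob.map1 φ c.tgt :=
  C.vert.t_fold _ _ _ _ c

/-- The extension of `φ` on 2-cells. -/
def lift2 : Cell2 X → C.glob.C2 :=
  C.horiz.fold (TwoGlob.map0 φ) (liftCol φ)
    (fun c => by rw [s_liftCol, TwoGlob.s₁_map]) (fun c => by rw [t_liftCol, TwoGlob.t₁_map])

theorem s_lift1 (p : Cell1 X) : C.glob.s₁ (lift1 φ p) = TwoGlob.map0 φ p.src :=
  C.cat1.s_fold _ _ _ _ p

theorem t_lift1 (p : Cell1 X) : C.glob.t₁ (lift1 φ p) = TwoGlob.map0 φ p.tgt :=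
  C.cat1.t_fold _ _ _ _ p

theorem ss_lift2 (α : Cell2 X) :
    C.glob.s₁ (C.glob.s₂ (lift2 φ α)) = TwoGlob.map0 φ α.src :=
  C.horiz.s_fold _ _ _ _ α

theorem tt_lift2 (α : Cell2 X) :
    C.glob.t₁ (C.glob.t₂ (lift2 φ α)) = TwoGlob.map0 φ α.tgt :=
  C.horiz.t_fold _ _ _ _ α

/-- The unfolding of `lift1` at the first edge of a path. -/
theorem lift1_cons (e : X.C1) (l : List X.C1) (b : X.C0) (hl : IsPath X.s₁ X.t₁ (X.t₁ e) l b) (h) :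
    lift1 φ ⟨X.s₁ e, b, e :: l, rfl, hl⟩ =
      C.cat1.comp (TwoGlob.map1 φ e) (lift1 φ ⟨X.t₁ e, b, l, hl⟩) h := rfl

/-- The unfolding of `lift2` at the first column of a 2-cell. -/
theorem lift2_cons (c : Column X) (l : List (Column X)) (a b : X.C0) (hl) (h) :
    lift2 φ ⟨a, b, c :: l, hl⟩ =
      C.horiz.comp (liftCol φ c) (lift2 φ ⟨X.t₁ c.tgt, b, l, hl.2⟩) h := rfl

theorem s_lift2 (α : Cell2 X) : C.glob.s₂ (lift2 φ α) = lift1 φ (src2 α) := by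
  obtain ⟨a, b, l, hl⟩ := α
  induction l generalizing a with
  | nil =>
    cases hl
    change C.glob.s₂ (C.horiz.id _) = C.cat1.id _
    rw [C.id_id, C.vert.s_id]; rfl
  | cons c l ih =>
    obtain ⟨rfl, hl⟩ := hl
    have h₁ : C.glob.t₁ (TwoGlob.map1 φ c.src) =
        C.glob.s₁ (C.glob.s₂ (lift2 φ ⟨X.t₁ c.tgt, b, l, hl⟩)) := by
      rw [TwoGlob.t₁_map, ss_lift2, Column.t_tgt]
    have h₂ : C.glob.t₁ (C.glob.t₂ (liftCol φ c)) =
        C.glob.s₁ (C.glob.s₂ (lift2 φ ⟨X.t₁ c.tgt, b, l, hl⟩)) := by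
      rw [t_liftCol, TwoGlob.t₁_map, ss_lift2]
    have h₃ : C.glob.t₁ (C.glob.s₂ (liftCol φ c)) =
        C.glob.s₁ (C.glob.s₂ (lift2 φ ⟨X.t₁ c.tgt, b, l, hl⟩)) := by
      rw [s_liftCol]; exact h₁
    rw [lift2_cons φ c l _ b ⟨rfl, hl⟩ h₂, C.s_horiz _ _ _ h₃]
    refine C.cat1.comp_congr (s_liftCol φ c) ((ih _ hl).trans ?_) _ _
    have hl' : IsPath X.s₁ X.t₁ (X.t₁ c.src) (l.map GPath.src) b := by
      rw [Column.t_tgt c]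
      exact (src2 ⟨X.t₁ c.tgt, b, l, hl⟩).isPath
    exact congrArg (lift1 φ) (GPath.ext_edges (p := src2 ⟨X.t₁ c.tgt, b, l, hl⟩)
      (q := ⟨X.t₁ c.src, b, l.map GPath.src, hl'⟩) (Column.t_tgt c).symm rfl)

theorem t_lift2 (α : Cell2 X) : C.glob.t₂ (lift2 φ α) = lift1 φ (tgt2 α) := by
  obtain ⟨a, b, l, hl⟩ := α
  induction l generalizing a with
  | nil =>
    cases hl
    change C.glob.t₂ (C.horiz.id _) = C.cat1.id _
    rw [C.id_id, C.vert.t_id]; rfl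
  | cons c l ih =>
    obtain ⟨rfl, hl⟩ := hl
    have h₂ : C.glob.t₁ (C.glob.t₂ (liftCol φ c)) =
        C.glob.s₁ (C.glob.s₂ (lift2 φ ⟨X.t₁ c.tgt, b, l, hl⟩)) := by
      rw [t_liftCol, TwoGlob.t₁_map, ss_lift2]
    have h₃ : C.glob.t₁ (C.glob.t₂ (liftCol φ c)) =
        C.glob.s₁ (C.glob.t₂ (lift2 φ ⟨X.t₁ c.tgt, b, l, hl⟩)) := by
      rw [C.glob.s₁_t₂]; exact h₂
    rw [lift2_cons φ c l _ b ⟨rfl, hl⟩ h₂, C.t_horiz _ _ _ h₃]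
    exact C.cat1.comp_congr (t_liftCol φ c) (ih _ hl) _ _

theorem lift2_id2 (p : Cell1 X) : lift2 φ (id2 p) = C.vert.id (lift1 φ p) := by
  obtain ⟨a, b, l, hl⟩ := p
  induction l generalizing a with
  | nil => cases hl; exact C.id_id _
  | cons e l ih =>
    obtain ⟨rfl, hl⟩ := hl
    have h₁ : C.glob.t₁ (TwoGlob.map1 φ e) = C.glob.s₁ (lift1 φ ⟨X.t₁ e, b, l, hl⟩) := by
      rw [TwoGlob.t₁_map, s_lift1]
    have h₂ : C.glob.t₁ (C.glob.t₂ (C.vert.id (TwoGlob.map1 φ e))) =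
        C.glob.s₁ (C.glob.s₂ (C.vert.id (lift1 φ ⟨X.t₁ e, b, l, hl⟩))) := by
      rw [C.vert.s_id, C.vert.t_id]; exact h₁
    rw [lift1_cons φ e l b hl h₁, C.id_comp _ _ _ h₂]
    exact C.horiz.comp_congr rfl (ih _ hl) _ _

theorem lift2_vcomp (α β : Cell2 X) (h) (h') : lift2 φ (vcomp α β h) =
    C.vert.comp (lift2 φ α) (lift2 φ β) h' := by
  obtain ⟨a, b, l, hl⟩ := α
  obtain ⟨a', b', m, hm⟩ := β
  have e₁ : a = a' := congrArg GPath.src h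
  have e₂ : b = b' := congrArg GPath.tgt h
  subst e₁ e₂
  have hlm : l.map GPath.tgt = m.map GPath.src := congrArg GPath.edges h
  induction l generalizing a m with
  | nil =>
    cases m with
    | cons _ _ => cases hlm
    | nil =>
      cases hl
      refine (C.vert.comp_id_of_eq _ (C.cat1.id (TwoGlob.map0 φ b)) ?_ ?_).symm.trans
        (C.vert.comp_congr rfl (C.id_id _).symm _ _)
      · change C.glob.t₂ (C.horiz.id _) = _
        rw [C.id_id, C.vert.t_id]; rfl
      · change C.glob.t₂ (C.horiz.id _) = _
        rw [C.id_id, C.vert.t_id, C.vert.s_id]; rfl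
  | cons c l ih =>
    cases m with
    | nil => cases hlm
    | cons d m =>
      have hcd : c.tgt = d.src := (List.cons.inj hlm).1
      have hlm' : l.map GPath.tgt = m.map GPath.src := (List.cons.inj hlm).2
      have hm2 : IsPath (fun c : Column X => X.s₁ c.src) (fun c : Column X => X.t₁ c.tgt)
          (X.t₁ c.tgt) m b := by
        have e : X.t₁ d.tgt = X.t₁ c.tgt := by rw [← Column.t_tgt d, ← hcd]
        rw [← e]
        exact hm.2
      have ht : tgt2 (X := X) ⟨X.t₁ c.tgt, b, l, hl.2⟩ = src2 ⟨X.t₁ c.tgt, b, m, hm2⟩ :=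
        GPath.ext_edges rfl hlm'
      have hv : C.glob.t₂ (lift2 φ ⟨X.t₁ c.tgt, b, l, hl.2⟩) =
          C.glob.s₂ (lift2 φ ⟨X.t₁ c.tgt, b, m, hm2⟩) := by
        rw [t_lift2, s_lift2, ht]
      have hr := ih (X.t₁ c.tgt) hl.2 m hm2 ht hv hlm'
      have hc : C.glob.t₂ (liftCol φ c) = C.glob.s₂ (liftCol φ d) := by
        rw [t_liftCol, s_liftCol, hcd]
      have hcomp : liftCol φ (c.comp d hcd) = C.vert.comp (liftCol φ c) (liftCol φ d) hc :=
        C.vert.fold_comp _ _ _ _ c d hcd hc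
      have k₁ : C.glob.t₁ (C.glob.t₂ (liftCol φ c)) =
          C.glob.s₁ (C.glob.s₂ (lift2 φ ⟨X.t₁ c.tgt, b, l, hl.2⟩)) := by
        rw [t_liftCol, TwoGlob.t₁_map, ss_lift2]
      have etgt : X.t₁ d.tgt = X.t₁ c.tgt := by rw [← Column.t_tgt, hcd]
      have k₂ : C.glob.t₁ (C.glob.t₂ (liftCol φ d)) =
          C.glob.s₁ (C.glob.s₂ (lift2 φ ⟨X.t₁ c.tgt, b, m, hm2⟩)) := by
        rw [t_liftCol, TwoGlob.t₁_map, ss_lift2, etgt]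
      have eqβ : lift2 φ ⟨a, b, d :: m, hm⟩ =
          C.horiz.comp (liftCol φ d) (lift2 φ ⟨X.t₁ c.tgt, b, m, hm2⟩) k₂ := by
        refine C.horiz.comp_congr rfl ?_ _ _
        change lift2 φ ⟨X.t₁ d.tgt, b, m, hm.2⟩ = _
        exact congrArg (lift2 φ) (GPath.ext_edges etgt rfl)
      have k₃ : C.glob.t₁ (C.glob.t₂ (C.vert.comp (liftCol φ c) (liftCol φ d) hc)) =
          C.glob.s₁ (C.glob.s₂ (C.vert.comp _ _ hv)) := by
        rw [C.vert.t_comp, C.vert.s_comp, t_liftCol, TwoGlob.t₁_map, ss_lift2, etgt]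
      have k₄ : C.glob.t₂ (C.horiz.comp (liftCol φ c) (lift2 φ ⟨X.t₁ c.tgt, b, l, hl.2⟩) k₁) =
          C.glob.s₂ (C.horiz.comp (liftCol φ d) (lift2 φ ⟨X.t₁ c.tgt, b, m, hm2⟩) k₂) := by
        rw [← eqβ]; exact h'
      refine Eq.trans ?_ ((C.interchange _ _ _ _ hc hv k₁ k₂ k₄ k₃).symm.trans
        (C.vert.comp_congr rfl eqβ.symm _ _))
      refine C.horiz.comp_congr hcomp (Eq.trans ?_ hr) _ _
      change lift2 φ ⟨X.t₁ d.tgt, b, vlist l m hlm', etgt ▸ vlist_isPath l m hlm' _ b hl.2⟩ = _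
      exact congrArg (lift2 φ) (GPath.ext_edges etgt rfl)

/-- The extension of `φ` to a strict 2-functor on the free 2-category. -/
def lift : twoCat X ⟶ C where
  toGlob := TwoGlob.homMk (X := glob X) (fun x => TwoGlob.map0 φ x) (lift1 φ) (lift2 φ)
    (s_lift1 φ) (t_lift1 φ) (s_lift2 φ) (t_lift2 φ)
  map_id₁ _ := rfl
  map_comp₁ f g h h' := C.cat1.fold_comp _ _ _ _ f g h h'
  map_id₂ := lift2_id2 φ
  map_vert := lift2_vcomp φ
  map_horiz α β h h' := C.horiz.fold_comp _ _ _ _ α β h h'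

theorem incl_lift : incl X ≫ (lift φ).toGlob = φ := by
  refine TwoGlob.hom_ext (fun _ => rfl) (fun x => ?_) (fun x => ?_)
  · exact C.cat1.fold_single _ _ _ _ x
  · exact (C.horiz.fold_single _ _ _ _ _).trans (C.vert.fold_single _ _ _ _ x)

theorem lift_unique (F : twoCat X ⟶ C) : lift (incl X ≫ F.toGlob) = F := by
  have H1 : ∀ p : Cell1 X, TwoGlob.map1 F.toGlob p = lift1 (incl X ≫ F.toGlob) p := fun p =>
    C.cat1.eq_fold _ _ _ _ (fun p => TwoGlob.map1 F.toGlob p) F.map_comp₁ F.map_id₁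
      (fun _ => rfl) p
  have HC : ∀ c : Column X, TwoGlob.map2 F.toGlob
      (GPath.single (fun c : Column X => X.s₁ c.src) (fun c : Column X => X.t₁ c.tgt) c) =
        liftCol (incl X ≫ F.toGlob) c := fun c => by
    refine C.vert.eq_fold _ _ _ _ (fun c => TwoGlob.map2 F.toGlob
      (GPath.single (fun c : Column X => X.s₁ c.src) (fun c : Column X => X.t₁ c.tgt) c))
      (fun c d h h' => ?_) (fun f => ?_) (fun _ => rfl) c
    · have hs : X.s₁ c.src = X.s₁ d.src := by rw [← h, Column.s_tgt]
      have hh : tgt2 (GPath.single _ _ c) = src2 (GPath.single _ _ d) :=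
        GPath.ext_edges hs (congrArg (fun x => [x]) h)
      have e : GPath.single (fun c : Column X => X.s₁ c.src) (fun c : Column X => X.t₁ c.tgt)
          (c.comp d h) = vcomp (GPath.single _ _ c) (GPath.single _ _ d) hh :=
        GPath.ext_edges rfl rfl
      exact (congrArg (TwoGlob.map2 F.toGlob) e).trans (F.map_vert _ _ hh h')
    · exact F.map_id₂ (GPath.single X.s₁ X.t₁ f)
  have H2 : ∀ α : Cell2 X, TwoGlob.map2 F.toGlob α = lift2 (incl X ≫ F.toGlob) α := fun α =>
    C.horiz.eq_fold _ _ _ _ (fun α => TwoGlob.map2 F.toGlob α) F.map_horiz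
      (fun a => (F.map_id₂ (GPath.nil X.s₁ X.t₁ a)).trans
        ((congrArg C.vert.id (F.map_id₁ a)).trans (C.id_id _).symm)) HC α
  exact StrictTwoCat.Hom.ext (TwoGlob.hom_ext (fun _ => rfl) (fun p => (H1 p).symm)
    (fun α => (H2 α).symm))

end Lift

/-- The universal property of the free 2-category. -/
def homEquiv (X : TwoGlob.{u}) (C : StrictTwoCat.{u}) :
    (twoCat X ⟶ C) ≃ (X ⟶ StrictTwoCat.forget.obj C) where
  toFun F := incl X ≫ F.toGlob
  invFun φ := lift φ
  left_inv F := lift_unique F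
  right_inv φ := incl_lift φ

/-- The free strict 2-category functor. -/
def functor : TwoGlob.{u} ⥤ StrictTwoCat.{u} :=
  Adjunction.leftAdjointOfEquiv (G := StrictTwoCat.forget) homEquiv (fun _ _ _ _ _ => rfl)

/-- The free strict 2-category functor is left adjoint to the forgetful functor. -/
def adj : functor.{u} ⊣ StrictTwoCat.forget.{u} :=
  Adjunction.adjunctionOfEquivLeft homEquiv (fun _ _ _ _ _ => rfl)

end Free

/-- The free strict 2-category monad on 2-globular sets. -/
def freeTwoCatMonad : Monad TwoGlob.{u} := Free.adj.toMonad

/-! ## Pasting diagrams -/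

/-- The set `pd(n)` of `n`-pasting diagrams: there is only one 0-pasting diagram, and an
`(n + 1)`-pasting diagram is a finite sequence of `n`-pasting diagrams. -/
def PD : ℕ → Type
  | 0 => Unit
  | n + 1 => List (PD n)

namespace PD

/-- The length of the sequence which constitutes a pasting diagram. A 1-pasting diagram of length
`n` is pictured as a chain of `n` arrows. -/
def len {n : ℕ} (P : PD (n + 1)) : ℕ := List.length P

/-- The members of the sequence which constitutes a pasting diagram. -/
def entry {n : ℕ} (P : PD (n + 1)) (i : Fin P.len) : PD n := List.get P i

/-- The height of the `i`-th column of a 2-pasting diagram, that is, the number of 2-cells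
stacked there. -/
def height (P : PD 2) (i : Fin P.len) : ℕ := (P.entry i).len

/-- A morphism of 2-pasting diagrams `P ⟶ Q`: a distance-preserving map from `{0, ..., P.len}`
to `{0, ..., Q.len}`, that is a translation by `shift`, together with, for every column `i` of
`P`, a distance-preserving map from `{0, ..., P.height i}` to `{0, ..., Q.height (shift + i)}`,
that is a translation by `vshift i`. -/
@[ext]
structure Hom (P Q : PD 2) where
  shift : ℕ
  shift_le : shift + P.len ≤ Q.len
  vshift : Fin P.len → ℕ
  vshift_le : ∀ i : Fin P.len, vshift i + P.height i ≤
    Q.height ⟨shift + i, lt_of_lt_of_le (Nat.add_lt_add_left i.isLt _) shift_le⟩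

/-- The action of a morphism on columns. -/
def Hom.col {P Q : PD 2} (f : Hom P Q) (i : Fin P.len) : Fin Q.len :=
  ⟨f.shift + i, lt_of_lt_of_le (Nat.add_lt_add_left i.isLt _) f.shift_le⟩

/-- The category `pd(2)`. -/
instance : SmallCategory (PD 2) where
  Hom := Hom
  id P := ⟨0, by simp, fun _ => 0, fun i => by
    apply le_of_eq; rw [Nat.zero_add]; congr 1; exact Fin.ext (Nat.zero_add _).symm⟩
  comp {P Q R} f g :=
    { shift := g.shift + f.shift
      shift_le := by have := f.shift_le; have := g.shift_le; omega
      vshift := fun i => g.vshift (f.col i) + f.vshift i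
      vshift_le := fun i => by
        have h₁ := f.vshift_le i
        have h₂ := g.vshift_le (f.col i)
        have e : (⟨g.shift + f.col i, lt_of_lt_of_le (Nat.add_lt_add_left (f.col i).isLt _)
            g.shift_le⟩ : Fin R.len) = ⟨g.shift + f.shift + i, by
              have := f.shift_le; have := g.shift_le; omega⟩ := Fin.ext (Nat.add_assoc _ _ _).symm
        rw [e] at h₂
        change f.vshift i + P.height i ≤ Q.height (f.col i) at h₁
        omega }
  id_comp {P Q} f := Hom.ext (Nat.add_zero _) (funext fun i =>
    congrArg f.vshift (Fin.ext (Nat.zero_add _)))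
  comp_id {P Q} f := Hom.ext (Nat.zero_add _) (funext fun i => Nat.zero_add _)
  assoc {P Q R S} f g h := Hom.ext (Nat.add_assoc _ _ _).symm (funext fun i => by
    change h.vshift _ + (g.vshift _ + f.vshift i) = (h.vshift _ + g.vshift _) + f.vshift i
    refine (Nat.add_assoc _ _ _).symm.trans ?_
    refine congrArg (fun j => h.vshift j + g.vshift (f.col i) + f.vshift i) ?_
    exact Fin.ext (Nat.add_assoc _ _ _))

/-- The 0-cells of a 2-pasting diagram: one more than there are columns. -/
@[ext]
structure Cell0 (P : PD 2) : Type u where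
  pos : Fin (P.len + 1)

/-- The 1-cells of a 2-pasting diagram: in every column, one more than there are 2-cells. -/
@[ext]
structure Cell1 (P : PD 2) : Type u where
  col : Fin P.len
  pos : Fin (P.height col + 1)

/-- The 2-cells of a 2-pasting diagram. -/
@[ext]
structure Cell2 (P : PD 2) : Type u where
  col : Fin P.len
  pos : Fin (P.height col)

/-- The 2-globular set pictured by a 2-pasting diagram: the 1-cells of column `i` lead from the
0-cell `i` to the 0-cell `i + 1`, and the `j`-th 2-cell of a column leads from its `j`-th to its
`(j + 1)`-st 1-cell. -/
def toGlob (P : PD 2) : TwoGlob.{u} :=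
  TwoGlob.mk (A₀ := Cell0.{u} P) (A₁ := Cell1.{u} P) (A₂ := Cell2.{u} P)
    (fun f => ⟨f.col.castSucc⟩) (fun f => ⟨f.col.succ⟩)
    (fun x => ⟨x.col, x.pos.castSucc⟩) (fun x => ⟨x.col, x.pos.succ⟩)
    (fun _ => rfl) (fun _ => rfl)

/-- The morphism of 2-globular sets pictured by a morphism of 2-pasting diagrams. -/
def Hom.toGlob {P Q : PD 2} (f : Hom P Q) : P.toGlob ⟶ Q.toGlob :=
  TwoGlob.homMk
    (fun x : Cell0.{u} P =>
      (⟨⟨f.shift + x.pos, by have := f.shift_le; omega⟩⟩ : Cell0.{u} Q))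
    (fun x : Cell1.{u} P =>
      (⟨f.col x.col, ⟨f.vshift x.col + x.pos, by
        have h : f.vshift x.col + P.height x.col ≤ Q.height (f.col x.col) := f.vshift_le x.col
        omega⟩⟩ : Cell1.{u} Q))
    (fun x : Cell2.{u} P =>
      (⟨f.col x.col, ⟨f.vshift x.col + x.pos, by
        have h : f.vshift x.col + P.height x.col ≤ Q.height (f.col x.col) := f.vshift_le x.col
        omega⟩⟩ : Cell2.{u} Q))
    (fun _ => rfl) (fun _ => rfl) (fun _ => rfl) (fun _ => rfl)

theorem Cell1.ext_val {P : PD 2} {x y : Cell1.{u} P} (h : x.col.val = y.col.val)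
    (h' : x.pos.val = y.pos.val) : x = y := by
  obtain ⟨a, b⟩ := x
  obtain ⟨c, d⟩ := y
  obtain rfl : a = c := Fin.ext h
  obtain rfl : b = d := Fin.ext h'
  rfl

theorem Cell2.ext_val {P : PD 2} {x y : Cell2.{u} P} (h : x.col.val = y.col.val)
    (h' : x.pos.val = y.pos.val) : x = y := by
  obtain ⟨a, b⟩ := x
  obtain ⟨c, d⟩ := y
  obtain rfl : a = c := Fin.ext h
  obtain rfl : b = d := Fin.ext h'
  rfl

/-- The functor `i₁ : pd(2) ⥤ 2-Glob`, sending a 2-pasting diagram to the 2-globular set which it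
pictures. -/
def realization : PD 2 ⥤ TwoGlob.{u} where
  obj P := P.toGlob
  map f := f.toGlob
  map_id _ := TwoGlob.hom_ext
    (fun _ => Cell0.ext (Fin.ext (Nat.zero_add _)))
    (fun _ => Cell1.ext_val (Nat.zero_add _) (Nat.zero_add _))
    (fun _ => Cell2.ext_val (Nat.zero_add _) (Nat.zero_add _))
  map_comp _ _ := TwoGlob.hom_ext
    (fun _ => Cell0.ext (Fin.ext (Nat.add_assoc _ _ _)))
    (fun _ => Cell1.ext_val (Nat.add_assoc _ _ _) (Nat.add_assoc _ _ _))
    (fun _ => Cell2.ext_val (Nat.add_assoc _ _ _) (Nat.add_assoc _ _ _))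

end PD

/-! ## Monads with arities -/

section Arities

variable {Θ : Type w} [SmallCategory Θ] {A : Type w'} [Category.{v} A]

/-- The nerve functor `A(i, 1) : A ⥤ (Θᵒᵖ ⥤ Type v)` of a functor `i : Θ ⥤ A`. -/
def arityNerve (i : Θ ⥤ A) : A ⥤ (Θᵒᵖ ⥤ Type v) :=
  yoneda ⋙ (Functor.whiskeringLeft _ _ _).obj i.op

/-- `T` is a monad with arities `i`: the functor `i` is fully faithful and dense, `T` is, with the
identity as universal transformation, a left Kan extension of `i ⋙ T` along `i`, and this left Kan
extension is preserved by the nerve functor of `i`. -/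
structure IsMonadWithArities (T : Monad A) (i : Θ ⥤ A) : Prop where
  full : i.Full
  faithful : i.Faithful
  dense : i.IsDense
  isLeftKanExtension : T.toFunctor.IsLeftKanExtension (L := i) (𝟙 (i ⋙ T.toFunctor))
  preserved : (T.toFunctor ⋙ arityNerve i).IsLeftKanExtension (L := i)
    (𝟙 (i ⋙ T.toFunctor ⋙ arityNerve i))

/-- A factorization `i n ⟶ T (i p) ⟶ T X` of a morphism `g : i n ⟶ T X`, where the second morphism
is the image under `T` of a morphism `i p ⟶ X`. -/
structure ArityFactorization (T : Monad A) (i : Θ ⥤ A) {n : Θ} {X : A}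
    (g : i.obj n ⟶ T.toFunctor.obj X) where
  p : Θ
  e : i.obj n ⟶ T.toFunctor.obj (i.obj p)
  f : i.obj p ⟶ X
  fac : e ≫ T.toFunctor.map f = g

/-- There is a morphism of factorizations from `φ` to `ψ`. -/
def ArityFactorization.Step {T : Monad A} {i : Θ ⥤ A} {n : Θ} {X : A}
    {g : i.obj n ⟶ T.toFunctor.obj X} (φ ψ : ArityFactorization T i g) : Prop :=
  ∃ k : φ.p ⟶ ψ.p, φ.e ≫ T.toFunctor.map (i.map k) = ψ.e ∧ i.map k ≫ ψ.f = φ.f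

end Arities

end TwoArities

open TwoArities

/-! The heart of the proof is that every `g : i₁P ⟶ TX` has a factorization admitting a morphism of
factorizations to every other one. Any two factorizations are then joined by a zig-zag through it,
and both Kan extension statements follow formally.

A morphism from a pasting diagram `P` to a 2-globular set `Y` is the same thing as a 2-cell of `TY`
whose columns have the heights prescribed by `P` (`PD.cellOf_injective`, `PD.exists_cellOf`). So `g`
is a 2-cell of `TTX`. Composing it (`Free.flatten`) gives a 2-cell of `TX`; let `F` be its shape, so
that this composite is a morphism `f : i₁F ⟶ X`. The missing `e : i₁P ⟶ Ti₁F` has to be a 2-cell of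
`TTi₁F` which lies over `g` and whose composite is the tautological 2-cell of `Ti₁F`.

Such an `e` exists, and is unique, because composition is cartesian: a 2-cell of `TTX` amounts to
its image in `TTY` together with its composite in `TX`, provided the two agree in `TY`
(`Free.exists_flatten`, `Free.flatten_injective`). This holds because `Tf` has unique lifting of
factorizations for vertical and for horizontal composition. For another factorization `(Q, e', f')`
the composite of `e'` lies over that of `g`, hence has shape `F` and gives a morphism `i₁F ⟶ i₁Q`.
The injectivity half of cartesianness makes it compatible with `e` and `e'`.

At each `n`, the sets `Hom(i n, T i p)` indexed by `i p ⟶ X` thus have colimit `Hom(i n, TX)`, which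
is the pointwise Kan extension after the nerve. The nerve of a dense functor is fully faithful and
reflects this colimit to `T` itself. Density holds because the representables are among the pasting
diagrams. -/

namespace TwoArities

/-! ### Paths given by finite sequences of vertices and edges -/

section Paths

variable {V V' : Type v} {E E' : Type*} {s t : E → V} {s' t' : E' → V'}

@[elab_as_elim]
theorem GPath.induction {motive : GPath s t → Prop} (nil : ∀ a, motive (GPath.nil s t a))
    (cons : ∀ e p h, motive p → motive ((GPath.single s t e).comp p h)) (p : GPath s t) :
    motive p := by
  obtain ⟨a, b, l, hl⟩ := p
  induction l generalizing a with
  | nil => cases hl; exact nil _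
  | cons e l ih =>
    obtain ⟨rfl, hl⟩ := hl
    exact cons e ⟨t e, b, l, hl⟩ rfl (ih _ hl)

theorem IsPath.of_append {l l' : List E} {a c : V} (h : IsPath s t a (l ++ l') c) :
    ∃ b, IsPath s t a l b ∧ IsPath s t b l' c := by
  induction l generalizing a with
  | nil => exact ⟨a, rfl, h⟩
  | cons e l ih =>
    obtain ⟨b, hb, hb'⟩ := ih h.2
    exact ⟨b, ⟨h.1, hb⟩, hb'⟩

theorem isPath_ofFn (n : ℕ) (v : Fin (n + 1) → V) (e : Fin n → E)
    (hs : ∀ i, s (e i) = v i.castSucc) (ht : ∀ i, t (e i) = v i.succ) :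
    IsPath s t (v 0) (List.ofFn e) (v (Fin.last n)) := by
  induction n with
  | zero => exact rfl
  | succ n ih =>
    rw [List.ofFn_succ]
    refine ⟨hs 0, ?_⟩
    rw [ht 0]
    exact ih (fun i => v i.succ) (fun i => e i.succ) (fun i => hs i.succ) (fun i => ht i.succ)

/-- The path with prescribed vertices and edges. -/
def GPath.ofFn (n : ℕ) (v : Fin (n + 1) → V) (e : Fin n → E)
    (hs : ∀ i, s (e i) = v i.castSucc) (ht : ∀ i, t (e i) = v i.succ) : GPath s t :=
  ⟨v 0, v (Fin.last n), List.ofFn e, isPath_ofFn n v e hs ht⟩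

/-- The initial vertex is the source of the path, and every later vertex is the target of an edge.
-/
theorem GPath.ofFn_injective {n : ℕ} {v v' : Fin (n + 1) → V} {e e' : Fin n → E} {hs ht hs' ht'}
    (h : GPath.ofFn (s := s) (t := t) n v e hs ht = GPath.ofFn n v' e' hs' ht') :
    v = v' ∧ e = e' := by
  have he : e = e' := List.ofFn_injective (congrArg GPath.edges h)
  refine ⟨?_, he⟩
  funext i
  refine Fin.cases (congrArg GPath.src h) (fun i => ?_) i
  rw [← ht, ← ht', he]

theorem GPath.exists_ofFn (p : GPath s t) {n : ℕ} (hn : p.edges.length = n) :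
    ∃ v e hs ht, GPath.ofFn n v e hs ht = p := by
  subst hn
  induction p using GPath.induction with
  | nil a => exact ⟨fun _ => a, Fin.elim0, fun i => i.elim0, fun i => i.elim0, rfl⟩
  | cons e p h ih =>
    obtain ⟨v, f, hs, ht, hp⟩ := ih
    have hv : v 0 = t e := (congrArg GPath.src hp).trans h.symm
    refine ⟨Fin.cons (s e) v, Fin.cons e f, ?_, ?_, ?_⟩
    · refine Fin.cases rfl fun i => ?_
      exact hs i
    · refine Fin.cases hv.symm fun i => ?_
      exact ht i
    · refine GPath.ext_edges rfl ?_
      have he : List.ofFn f = p.edges := congrArg GPath.edges hp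
      change List.ofFn (Fin.cons e f) = e :: p.edges
      exact (List.ofFn_cons e f).trans (congrArg (e :: ·) he)

theorem GPath.map_comp {f : V → V'} {g : E → E'} (hs : ∀ e, s' (g e) = f (s e))
    (ht : ∀ e, t' (g e) = f (t e)) (p q : GPath s t) (h) :
    (p.comp q h).map f g hs ht =
      (p.map f g hs ht).comp (q.map f g hs ht) (congrArg f h) :=
  GPath.ext_edges rfl List.map_append

theorem list_map_map {A B C : Type*} (g : A → B) (g' : B → C) (g'' : A → C) (l : List A)
    (h : ∀ x, g' (g x) = g'' x) : (l.map g).map g' = l.map g'' := by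
  rw [List.map_map]
  exact List.map_congr_left fun x _ => h x

theorem GPath.map_ofFn {f : V → V'} {g : E → E'} (hs : ∀ e, s' (g e) = f (s e))
    (ht : ∀ e, t' (g e) = f (t e)) {n : ℕ} {v : Fin (n + 1) → V} {e : Fin n → E} {h₁ h₂} :
    (GPath.ofFn n v e h₁ h₂).map f g hs ht = GPath.ofFn n (fun i => f (v i)) (fun i => g (e i))
      (fun i => (hs _).trans (congrArg f (h₁ i))) (fun i => (ht _).trans (congrArg f (h₂ i))) :=
  GPath.ext_edges rfl List.map_ofFn

end Paths

/-! ### Unique lifting of factorizations, extended to composites of paths -/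

section Lifting

variable {V V' : Type v} {E E' A A' : Type*} {s t : E → V} {s' t' : E' → V'}
  {σ τ : A → V} {σ' τ' : A' → V'}

/-- A functor (given by `p₀` on objects and `p` on arrows) which has unique lifting of
factorizations. -/
structure CatStr.LiftsFactorizations (K' : CatStr σ' τ') (K : CatStr σ τ) (p₀ : V' → V)
    (p : A' → A) : Prop where
  s_map : ∀ x, σ (p x) = p₀ (σ' x)
  t_map : ∀ x, τ (p x) = p₀ (τ' x)
  map_id : ∀ a, p (K'.id a) = K.id (p₀ a)
  map_comp : ∀ x y h h', p (K'.comp x y h) = K.comp (p x) (p y) h'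
  lift_id : ∀ x a, p x = K.id a → x = K'.id (σ' x)
  lift_comp : ∀ x a b h, p x = K.comp a b h →
    ∃ a' b' h', K'.comp a' b' h' = x ∧ p a' = a ∧ p b' = b
  comp_inj : ∀ a b h a' b' h', K'.comp a b h = K'.comp a' b' h' → p a = p a' → p b = p b' →
    a = a' ∧ b = b'

variable {K' : CatStr σ' τ'} {K : CatStr σ τ} {p₀ : V' → V} {p : A' → A}
  {g : E → A} {hs : ∀ e, σ (g e) = _root_.id (s e)} {ht : ∀ e, τ (g e) = _root_.id (t e)}
  {g' : E' → A'} {hs' : ∀ e, σ' (g' e) = _root_.id (s' e)} {ht' : ∀ e, τ' (g' e) = _root_.id (t' e)}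
  {q : E' → E} {hqs : ∀ e, s (q e) = p₀ (s' e)} {hqt : ∀ e, t (q e) = p₀ (t' e)}

/-- Only functoriality matters here. Edges are sent to arrows by arbitrary `g`, `g'`, so that the
lemma serves both for 2-cells composed vertically and for whole columns composed horizontally. -/
theorem CatStr.LiftsFactorizations.map_fold (H : K'.LiftsFactorizations K p₀ p)
    (hg : ∀ e, p (g' e) = g (q e)) (x : GPath s' t') :
    p (K'.fold _root_.id g' hs' ht' x) = K.fold _root_.id g hs ht (x.map p₀ q hqs hqt) := by
  induction x using GPath.induction with
  | nil a => exact H.map_id a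
  | cons e x h ih =>
    have h₁ : τ' (K'.fold _root_.id g' hs' ht' (GPath.single s' t' e)) =
        σ' (K'.fold _root_.id g' hs' ht' x) := by
      rw [K'.t_fold, K'.s_fold, h]
    have h₂ : τ (p (K'.fold _root_.id g' hs' ht' (GPath.single s' t' e))) =
        σ (p (K'.fold _root_.id g' hs' ht' x)) := by
      rw [H.s_map, H.t_map, h₁]
    have h₃ : τ (K.fold _root_.id g hs ht ((GPath.single s' t' e).map p₀ q hqs hqt)) =
        σ (K.fold _root_.id g hs ht (x.map p₀ q hqs hqt)) := by
      rw [K.t_fold, K.s_fold]; exact congrArg p₀ h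
    rw [K'.fold_comp _ _ _ _ _ _ _ h₁, H.map_comp _ _ _ h₂, GPath.map_comp]
    refine Eq.trans (K.comp_congr ?_ ih _ h₃) (K.fold_comp _ _ _ _ _ _ _ h₃).symm
    rw [K'.fold_single, hg]
    have e' : (GPath.single s' t' e).map p₀ q hqs hqt = GPath.single s t (q e) :=
      GPath.ext_edges (hqs e).symm rfl
    rw [e', K.fold_single]

/-- Existence half of cartesianness of composition: `lift_comp` splits off a first factor of `x`,
the hypothesis `hl` makes it an edge, and the remainder is treated by induction. -/
theorem CatStr.LiftsFactorizations.exists_fold (H : K'.LiftsFactorizations K p₀ p)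
    (hl : ∀ e x, p x = g e → ∃ e', q e' = e ∧ g' e' = x) (y : GPath s t) (x : A')
    (h : p x = K.fold _root_.id g hs ht y) :
    ∃ y' : GPath s' t', y'.map p₀ q hqs hqt = y ∧ K'.fold _root_.id g' hs' ht' y' = x := by
  induction y using GPath.induction generalizing x with
  | nil a =>
    refine ⟨GPath.nil s' t' (σ' x), ?_, (H.lift_id x a h).symm⟩
    refine GPath.ext_edges ?_ rfl
    change p₀ (σ' x) = a
    rw [← H.s_map, h]
    exact K.s_id a
  | cons e y hy ih =>
    have h₁ : τ (K.fold _root_.id g hs ht (GPath.single s t e)) = σ (K.fold _root_.id g hs ht y) := by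
      rw [K.t_fold, K.s_fold, hy]
    rw [K.fold_comp _ _ _ _ _ _ _ h₁] at h
    obtain ⟨a', b', hab, rfl, ha, hb⟩ := H.lift_comp _ _ _ _ h
    rw [K.fold_single] at ha
    obtain ⟨e', rfl, rfl⟩ := hl _ _ ha
    obtain ⟨y', rfl, rfl⟩ := ih _ hb
    have hy' : (GPath.single s' t' e').tgt = y'.src :=
      (ht' e').symm.trans (hab.trans (K'.s_fold _ _ _ _ y'))
    refine ⟨(GPath.single s' t' e').comp y' hy', ?_, ?_⟩
    · exact GPath.ext_edges (hqs e').symm rfl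
    · have h₂ : τ' (K'.fold _root_.id g' hs' ht' (GPath.single s' t' e')) =
          σ' (K'.fold _root_.id g' hs' ht' y') := by
        rw [K'.t_fold, K'.s_fold, hy']
      rw [K'.fold_comp _ _ _ _ _ _ _ h₂]
      exact K'.comp_congr (K'.fold_single _ _ _ _ _) rfl _ _

/-- Uniqueness half: first edge and remainder give two factorizations of the same arrow with equal
images, which `comp_inj` identifies. -/
theorem CatStr.LiftsFactorizations.fold_injective (H : K'.LiftsFactorizations K p₀ p)
    (hg : ∀ e, p (g' e) = g (q e)) (hinj : ∀ e₁ e₂, q e₁ = q e₂ → g' e₁ = g' e₂ → e₁ = e₂)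
    (hs : ∀ e, σ (g e) = _root_.id (s e)) (ht : ∀ e, τ (g e) = _root_.id (t e))
    (x y : GPath s' t') (h : x.map p₀ q hqs hqt = y.map p₀ q hqs hqt)
    (h' : K'.fold _root_.id g' hs' ht' x = K'.fold _root_.id g' hs' ht' y) : x = y := by
  have hsrc : ∀ x y : GPath s' t', K'.fold _root_.id g' hs' ht' x = K'.fold _root_.id g' hs' ht' y →
      x.src = y.src := fun x y h => by
    have := congrArg σ' h
    rwa [K'.s_fold, K'.s_fold] at this
  induction x using GPath.induction generalizing y with
  | nil a =>
    have hy : y.edges = [] := List.map_eq_nil_iff.1 (congrArg GPath.edges h).symm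
    exact GPath.ext_edges (hsrc _ _ h') hy.symm
  | cons e x hx ih =>
    induction y using GPath.induction with
    | nil a => cases congrArg GPath.edges h
    | cons f y hy _ =>
      have hl := List.cons.inj (congrArg GPath.edges h)
      have h₁ : τ' (K'.fold _root_.id g' hs' ht' (GPath.single s' t' e)) =
          σ' (K'.fold _root_.id g' hs' ht' x) := by rw [K'.t_fold, K'.s_fold, hx]
      have h₂ : τ' (K'.fold _root_.id g' hs' ht' (GPath.single s' t' f)) =
          σ' (K'.fold _root_.id g' hs' ht' y) := by rw [K'.t_fold, K'.s_fold, hy]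
      have hef : q e = q f := hl.1
      have hxy : x.map p₀ q hqs hqt = y.map p₀ q hqs hqt := by
        refine GPath.ext_edges ?_ hl.2
        change p₀ x.src = p₀ y.src
        rw [← hx, ← hy]
        change p₀ (t' e) = p₀ (t' f)
        rw [← hqt, ← hqt, hef]
      rw [K'.fold_comp _ _ _ _ _ _ _ h₁, K'.fold_comp _ _ _ _ _ _ _ h₂] at h'
      have := H.comp_inj _ _ _ _ _ _ h' (by rw [K'.fold_single, K'.fold_single, hg, hg, hef])
        (by rw [H.map_fold hg (hs := hs) (ht := ht) (hqs := hqs) (hqt := hqt),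
          H.map_fold hg (hs := hs) (ht := ht) (hqs := hqs) (hqt := hqt), hxy])
      rw [K'.fold_single, K'.fold_single] at this
      obtain rfl := hinj e f hef this.1
      obtain rfl := ih y hxy this.2
      rfl

/-- The functor between free categories induced by a morphism of graphs has unique lifting of
factorizations. -/
theorem pathCat_liftsFactorizations (f : V' → V) (q : E' → E) (hqs : ∀ e, s (q e) = f (s' e))
    (hqt : ∀ e, t (q e) = f (t' e)) :
    (pathCat s' t').LiftsFactorizations (pathCat s t) f (GPath.map f q hqs hqt) where
  s_map _ := rfl
  t_map _ := rfl
  map_id _ := rfl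
  map_comp x y h _ := GPath.map_comp _ _ x y h
  lift_id x a h :=
    GPath.ext_edges rfl (List.map_eq_nil_iff.1 (congrArg GPath.edges h))
  lift_comp x a b h hx := by
    obtain ⟨l₁, l₂, hl, h₁, h₂⟩ := List.map_eq_append_iff.1 (congrArg GPath.edges hx)
    obtain ⟨x₀, x₁, l, hp⟩ := x
    change l = l₁ ++ l₂ at hl
    subst hl
    obtain ⟨m, hm₁, hm₂⟩ := hp.of_append
    have hx₀ := congrArg GPath.src hx
    have ha : GPath.map f q hqs hqt ⟨x₀, m, l₁, hm₁⟩ = a :=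
      GPath.ext_edges hx₀ h₁
    refine ⟨⟨x₀, m, l₁, hm₁⟩, ⟨m, x₁, l₂, hm₂⟩, rfl, rfl, ha, ?_⟩
    exact GPath.ext_edges ((congrArg GPath.tgt ha).trans h) h₂
  comp_inj a b h a' b' h' hc ha hb := by
    -- Equal images force equal lengths, so the two concatenations are cut at the same place.
    have hl : a.edges.length = a'.edges.length := by
      have := congrArg (fun p : GPath s t => p.edges.length) ha
      simpa [GPath.map] using this
    obtain ⟨h₁, h₂⟩ := List.append_inj (congrArg GPath.edges hc) hl
    have hsrc := congrArg GPath.src hc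
    obtain rfl : a = a' := GPath.ext_edges hsrc h₁
    have h0 : a.tgt = b.src := h
    have h0' : a.tgt = b'.src := h'
    exact ⟨rfl, GPath.ext_edges (h0.symm.trans h0') h₂⟩

end Lifting

/-! ### The free 2-category on morphisms, and cartesianness of composition -/

namespace Free

variable {X Y Z : TwoGlob.{u}}

/-- The action of a morphism of 2-globular sets on paths of 1-cells. -/
def pathMap (f : X ⟶ Y) : Cell1 X → Cell1 Y :=
  GPath.map (TwoGlob.map0 f) (TwoGlob.map1 f) (TwoGlob.s₁_map f) (TwoGlob.t₁_map f)

/-- The action of a morphism of 2-globular sets on vertical paths of 2-cells. -/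
def colMap (f : X ⟶ Y) : Column X → Column Y :=
  GPath.map (TwoGlob.map1 f) (TwoGlob.map2 f) (TwoGlob.s₂_map f) (TwoGlob.t₂_map f)

/-- The action of a morphism of 2-globular sets on horizontal paths of vertical paths. -/
def cellMap (f : X ⟶ Y) : Cell2 X → Cell2 Y :=
  GPath.map (TwoGlob.map0 f) (colMap f) (fun c => TwoGlob.s₁_map f c.src)
    (fun c => TwoGlob.t₁_map f c.tgt)

theorem src2_cellMap (f : X ⟶ Y) (α : Cell2 X) : src2 (cellMap f α) = pathMap f (src2 α) :=
  GPath.ext_edges rfl ((list_map_map (colMap f) GPath.src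
    (fun c : Column X => TwoGlob.map1 f c.src) α.edges fun _ => rfl).trans
    (list_map_map GPath.src (TwoGlob.map1 f) _ α.edges fun _ => rfl).symm)

theorem tgt2_cellMap (f : X ⟶ Y) (α : Cell2 X) : tgt2 (cellMap f α) = pathMap f (tgt2 α) :=
  GPath.ext_edges rfl ((list_map_map (colMap f) GPath.tgt
    (fun c : Column X => TwoGlob.map1 f c.tgt) α.edges fun _ => rfl).trans
    (list_map_map GPath.tgt (TwoGlob.map1 f) _ α.edges fun _ => rfl).symm)

/-- The morphism between free 2-categories induced by a morphism of 2-globular sets. -/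
def globMap (f : X ⟶ Y) : glob X ⟶ glob Y :=
  TwoGlob.homMk (X := glob X) (Y := glob Y) (TwoGlob.map0 (X := X) (Y := Y) f)
    (pathMap f) (cellMap f)
    (fun _ => rfl) (fun _ => rfl) (src2_cellMap f) (tgt2_cellMap f)

theorem colMap_comp (f : X ⟶ Y) (g : Y ⟶ Z) (c : Column X) :
    colMap (f ≫ g) c = colMap g (colMap f c) :=
  GPath.ext_edges rfl (list_map_map (TwoGlob.map2 f) (TwoGlob.map2 g) (TwoGlob.map2 (f ≫ g)) c.edges
    fun _ => rfl).symm

theorem cellMap_comp (f : X ⟶ Y) (g : Y ⟶ Z) (α : Cell2 X) :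
    cellMap (f ≫ g) α = cellMap g (cellMap f α) :=
  GPath.ext_edges rfl (list_map_map (colMap f) (colMap g) (colMap (f ≫ g)) α.edges
    fun c => (colMap_comp f g c).symm).symm

theorem pathMap_comp (f : X ⟶ Y) (g : Y ⟶ Z) (p : Cell1 X) :
    pathMap (f ≫ g) p = pathMap g (pathMap f p) :=
  GPath.ext_edges rfl (list_map_map (TwoGlob.map1 f) (TwoGlob.map1 g) (TwoGlob.map1 (f ≫ g)) p.edges
    fun _ => rfl).symm

theorem globMap_comp (f : X ⟶ Y) (g : Y ⟶ Z) : globMap (f ≫ g) = globMap f ≫ globMap g :=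
  TwoGlob.hom_ext (fun _ => rfl) (pathMap_comp f g) (cellMap_comp f g)

theorem colMap_vert_comp (f : X ⟶ Y) (c d : Column X) (h) (h') :
    colMap f (c.comp d h) = (colMap f c).comp (colMap f d) h' :=
  GPath.map_comp _ _ c d h

theorem map_vlist (f : X ⟶ Y) (l m : List (Column X)) (h) (h') :
    (vlist l m h).map (colMap f) = vlist (l.map (colMap f)) (m.map (colMap f)) h' := by
  induction l generalizing m with
  | nil =>
    cases m with
    | nil => rfl
    | cons d m => cases h
  | cons c l ih =>
    cases m with
    | nil => cases h
    | cons d m => exact congrArg₂ List.cons (colMap_vert_comp f c d _ _) (ih m _ _)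

/-- Vertical composition acts columnwise, so this is unique lifting for paths of 2-cells, applied in
each column. -/
theorem exists_vlist_of_map_eq (f : X ⟶ Y) (k : List (Column X)) (l m : List (Column Y)) (h)
    (hk : k.map (colMap f) = vlist l m h) :
    ∃ l' m' h', vlist l' m' h' = k ∧ l'.map (colMap f) = l ∧ m'.map (colMap f) = m := by
  induction k generalizing l m with
  | nil =>
    cases l with
    | nil =>
      cases m with
      | nil => exact ⟨[], [], rfl, rfl, rfl, rfl⟩
      | cons d m => cases h
    | cons c l =>
      cases m with
      | nil => cases h
      | cons d m => cases hk
  | cons b k ih =>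
    cases l with
    | nil =>
      cases m with
      | nil => cases hk
      | cons d m => cases h
    | cons c l =>
      cases m with
      | nil => cases h
      | cons d m =>
        have hk' := List.cons.inj hk
        obtain ⟨l', m', h', rfl, rfl, rfl⟩ := ih l m _ hk'.2
        obtain ⟨c', d', hcd, rfl, rfl, rfl⟩ :=
          (pathCat_liftsFactorizations (TwoGlob.map1 f) (TwoGlob.map2 f) (TwoGlob.s₂_map f)
            (TwoGlob.t₂_map f)).lift_comp b c d (List.cons.inj h).1 hk'.1
        exact ⟨c' :: l', d' :: m', congrArg₂ List.cons hcd h', rfl, rfl, rfl⟩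

theorem vlist_injective (f : X ⟶ Y) (l m l' m' : List (Column X)) (h) (h')
    (hk : vlist l m h = vlist l' m' h') (hl : l.map (colMap f) = l'.map (colMap f))
    (hm : m.map (colMap f) = m'.map (colMap f)) : l = l' ∧ m = m' := by
  induction l generalizing m l' m' with
  | nil =>
    obtain rfl : l' = [] := List.map_eq_nil_iff.1 hl.symm
    exact ⟨rfl, (List.map_eq_nil_iff.1 h.symm).trans (List.map_eq_nil_iff.1 h'.symm).symm⟩
  | cons c l ih =>
    cases m with
    | nil => cases h
    | cons d m =>
      cases l' with
      | nil => cases hl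
      | cons c' l' =>
        cases m' with
        | nil => cases h'
        | cons d' m' =>
          have hk' := List.cons.inj hk
          have hl' := List.cons.inj hl
          have hm' := List.cons.inj hm
          obtain ⟨rfl, rfl⟩ := ih m l' m' _ _ hk'.2 hl'.2 hm'.2
          obtain ⟨rfl, rfl⟩ :=
            (pathCat_liftsFactorizations (TwoGlob.map1 f) (TwoGlob.map2 f) (TwoGlob.s₂_map f)
              (TwoGlob.t₂_map f)).comp_inj c d (List.cons.inj h).1 c' d' (List.cons.inj h').1
              hk'.1 hl'.1 hm'.1
          exact ⟨rfl, rfl⟩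

/-- Lifting produces mere lists of columns. They are horizontal paths because, by globularity, a
composite column and its two halves share their bounding 0-cells. -/
theorem isPath_of_vlist (l m : List (Column X)) (h) (a b : X.C0)
    (hp : IsPath (fun c : Column X => X.s₁ c.src) (fun c : Column X => X.t₁ c.tgt) a
      (vlist l m h) b) :
    IsPath (fun c : Column X => X.s₁ c.src) (fun c : Column X => X.t₁ c.tgt) a l b ∧
      IsPath (fun c : Column X => X.s₁ c.src) (fun c : Column X => X.t₁ c.tgt) a m b := by
  induction l generalizing m a with
  | nil =>
    cases m with
    | nil => exact ⟨hp, hp⟩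
    | cons d m => cases h
  | cons c l ih =>
    cases m with
    | nil => cases h
    | cons d m =>
      have hcd : c.tgt = d.src := (List.cons.inj h).1
      obtain ⟨h₁, h₂⟩ := ih m _ _ hp.2
      have e : X.t₁ (c.comp d hcd).tgt = X.t₁ c.tgt := by
        rw [← Column.t_tgt c, ← Column.t_tgt]; rfl
      refine ⟨⟨hp.1, ?_⟩, ⟨?_, h₂⟩⟩
      · change IsPath _ _ (X.t₁ c.tgt) l b
        rw [← e]; exact h₁
      · change X.s₁ d.src = a
        rw [← hcd, Column.s_tgt]
        exact hp.1

theorem vert_liftsFactorizations (f : X ⟶ Y) :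
    (twoCat X).vert.LiftsFactorizations (twoCat Y).vert (pathMap f) (cellMap f) where
  s_map := src2_cellMap f
  t_map := tgt2_cellMap f
  map_id p := GPath.ext_edges rfl ((list_map_map (GPath.nil X.s₂ X.t₂) (colMap f)
    (fun x : X.C1 => GPath.nil Y.s₂ Y.t₂ (TwoGlob.map1 f x)) p.edges fun _ => rfl).trans
    (list_map_map (TwoGlob.map1 f) (GPath.nil Y.s₂ Y.t₂) _ p.edges fun _ => rfl).symm)
  map_comp α β h h' := GPath.ext_edges rfl (map_vlist f _ _ _ _)
  lift_id α p h := by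
    refine GPath.ext_edges rfl ?_
    have hl : α.edges.map (colMap f) = p.edges.map (GPath.nil Y.s₂ Y.t₂) :=
      congrArg GPath.edges h
    change α.edges = (α.edges.map GPath.src).map (GPath.nil X.s₂ X.t₂)
    rw [List.map_map]
    -- Each column has an empty image, hence is itself empty, that is, an identity.
    refine (List.map_id _).symm.trans (List.map_congr_left fun c hc => ?_)
    have hc' : colMap f c ∈ p.edges.map (GPath.nil Y.s₂ Y.t₂) :=
      hl ▸ List.mem_map_of_mem hc
    obtain ⟨x, -, hx⟩ := List.mem_map.1 hc'
    exact GPath.ext_edges rfl (List.map_eq_nil_iff.1 (congrArg GPath.edges hx).symm)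
  lift_comp γ α β h hγ := by
    have hsrc := congrArg GPath.src hγ
    have htgt := congrArg GPath.tgt hγ
    have hsrc' := congrArg GPath.src h
    obtain ⟨l, m, hlm, hk, hl, hm⟩ :=
      exists_vlist_of_map_eq f γ.edges α.edges β.edges _ (congrArg GPath.edges hγ)
    have hp := γ.isPath
    rw [← hk] at hp
    obtain ⟨hpl, hpm⟩ := isPath_of_vlist l m hlm _ _ hp
    exact ⟨⟨γ.src, γ.tgt, l, hpl⟩, ⟨γ.src, γ.tgt, m, hpm⟩, GPath.ext_edges rfl hlm,
      GPath.ext_edges rfl hk, GPath.ext_edges hsrc hl, GPath.ext_edges (hsrc.trans hsrc') hm⟩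
  comp_inj α β h α' β' h' hγ hα hβ := by
    have hsrc := congrArg GPath.src hγ
    have hs := congrArg GPath.src h
    have hs' := congrArg GPath.src h'
    obtain ⟨h₁, h₂⟩ := vlist_injective f _ _ _ _ _ _ (congrArg GPath.edges hγ)
      (congrArg GPath.edges hα) (congrArg GPath.edges hβ)
    exact ⟨GPath.ext_edges hsrc h₁, GPath.ext_edges (hs.symm.trans (hsrc.trans hs')) h₂⟩

theorem horiz_liftsFactorizations (f : X ⟶ Y) :
    (twoCat X).horiz.LiftsFactorizations (twoCat Y).horiz (TwoGlob.map0 (X := X) (Y := Y) f)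
      (cellMap f) :=
  pathCat_liftsFactorizations (TwoGlob.map0 f) (colMap f) (fun c => TwoGlob.s₁_map f c.src)
    (fun c => TwoGlob.t₁_map f c.tgt)

variable (X) in
/-- The vertical composite of a vertical path of 2-cells of a free 2-category. -/
def flattenCol : Column (glob X) → Cell2 X :=
  (twoCat X).vert.fold id id (fun _ => rfl) (fun _ => rfl)

variable (X) in
/-- The composite of a horizontal path of vertical paths of 2-cells of a free 2-category. -/
def flatten : Cell2 (glob X) → Cell2 X :=
  (twoCat X).horiz.fold id (flattenCol X)
    (fun c => congrArg GPath.src ((twoCat X).vert.s_fold id id (fun _ => rfl) (fun _ => rfl) c))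
    (fun c => congrArg GPath.tgt ((twoCat X).vert.t_fold id id (fun _ => rfl) (fun _ => rfl) c))

theorem flattenCol_map (f : X ⟶ Y) (c : Column (glob X)) :
    flattenCol Y (colMap (globMap f) c) = cellMap f (flattenCol X c) :=
  ((vert_liftsFactorizations f).map_fold (g := id) (g' := id) (q := cellMap f)
    (fun _ => rfl) c).symm

/-- Naturality of composition; the columnwise version supplies the compatibility of edges. -/
theorem flatten_map (f : X ⟶ Y) (α : Cell2 (glob X)) :
    flatten Y (cellMap (globMap f) α) = cellMap f (flatten X α) :=
  ((horiz_liftsFactorizations f).map_fold (fun c => (flattenCol_map f c).symm) α).symm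

theorem exists_flattenCol (f : X ⟶ Y) (c : Column (glob Y)) (β : Cell2 X)
    (h : cellMap f β = flattenCol Y c) :
    ∃ c' : Column (glob X), colMap (globMap f) c' = c ∧ flattenCol X c' = β :=
  (vert_liftsFactorizations f).exists_fold (q := cellMap f) (g := id) (g' := id)
    (fun _ x hx => ⟨x, hx, rfl⟩) c β h

/-- With `flatten_injective`, this says that the naturality square of `flatten` at `f` is a
pullback. The statement for columns feeds the horizontal step as its hypothesis on edges. -/
theorem exists_flatten (f : X ⟶ Y) (α : Cell2 (glob Y)) (β : Cell2 X)
    (h : cellMap f β = flatten Y α) :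
    ∃ α' : Cell2 (glob X), cellMap (globMap f) α' = α ∧ flatten X α' = β :=
  (horiz_liftsFactorizations f).exists_fold (q := colMap (globMap f)) (g := flattenCol Y)
    (g' := flattenCol X) (exists_flattenCol f) α β h

theorem flattenCol_injective (f : X ⟶ Y) (c c' : Column (glob X))
    (h : colMap (globMap f) c = colMap (globMap f) c')
    (h' : flattenCol X c = flattenCol X c') : c = c' :=
  (vert_liftsFactorizations f).fold_injective (q := cellMap f) (g := id) (g' := id)
    (fun _ => rfl) (fun _ _ _ h => h) (fun _ => rfl) (fun _ => rfl) c c' h h'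

theorem flatten_injective (f : X ⟶ Y) (α α' : Cell2 (glob X))
    (h : cellMap (globMap f) α = cellMap (globMap f) α')
    (h' : flatten X α = flatten X α') : α = α' :=
  (horiz_liftsFactorizations f).fold_injective (q := colMap (globMap f)) (g := flattenCol Y)
    (g' := flattenCol X) (fun c => (flattenCol_map f c).symm) (flattenCol_injective f)
    (fun c => congrArg GPath.src ((twoCat Y).vert.s_fold id id (fun _ => rfl) (fun _ => rfl) c))
    (fun c => congrArg GPath.tgt ((twoCat Y).vert.t_fold id id (fun _ => rfl) (fun _ => rfl) c))
    α α' h h'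

/-- The strict 2-functor between free 2-categories induced by a morphism of 2-globular sets. -/
def twoCatMap (f : X ⟶ Y) : twoCat X ⟶ twoCat Y where
  toGlob := globMap f
  map_id₁ _ := rfl
  map_comp₁ p q h _ := GPath.map_comp (TwoGlob.s₁_map f) (TwoGlob.t₁_map f) p q h
  map_id₂ := (vert_liftsFactorizations f).map_id
  map_vert := (vert_liftsFactorizations f).map_comp
  map_horiz := (horiz_liftsFactorizations f).map_comp

theorem functor_map (f : X ⟶ Y) : functor.map f = twoCatMap f := by
  refine Eq.trans ?_ (lift_unique (twoCatMap f))
  -- The left adjoint built from `homEquiv` sends `f` to the transpose of `f` followed by the unit;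
  -- the explicit 2-functor has the same restriction to generators.
  change lift (f ≫ incl Y ≫ 𝟙 _) = _
  rw [Category.comp_id]
  refine congrArg lift (TwoGlob.hom_ext (fun _ => rfl) (fun x => ?_) (fun x => ?_))
  · exact GPath.ext_edges (TwoGlob.s₁_map f x) rfl
  · refine GPath.ext_edges ((congrArg Y.s₁ (TwoGlob.s₂_map f x)).trans
      (TwoGlob.s₁_map f _)) ?_
    exact congrArg (fun c => [c]) (GPath.ext_edges (TwoGlob.s₂_map f x) rfl)

theorem monad_map (f : X ⟶ Y) : freeTwoCatMonad.toFunctor.map f = globMap f :=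
  show StrictTwoCat.forget.map (functor.map f) = _ from
    congrArg StrictTwoCat.Hom.toGlob (functor_map f)

end Free

/-! ### Nerves of dense functors and Kan extensions from weakly initial factorizations -/

section Arities

open Limits

variable {Θ : Type w} [SmallCategory Θ] {A : Type w'} [Category.{v} A]

/-- The elements of the nerve of an object are the legs of its canonical colimit cocone, and these
are jointly epic. -/
theorem arityNerve_faithful (i : Θ ⥤ A) [i.IsDense] : (arityNerve i).Faithful where
  map_injective h :=
    (i.denseAt _).hom_ext' fun X p => (Category.id_comp _).trans
      ((ConcreteCategory.congr_hom (NatTrans.congr_app h (.op X)) p).trans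
        (Category.id_comp _).symm)

/-- A transformation between nerves is a cocone on the canonical diagram of `Y`, so it is induced by
a morphism out of `Y`. -/
theorem arityNerve_full (i : Θ ⥤ A) [i.IsDense] : (arityNerve i).Full where
  map_surjective {Y Z} f := by
    let c : Cocone (CostructuredArrow.proj i Y ⋙ i) :=
      { pt := Z
        ι :=
          { app := fun g => f.app (.op g.left) g.hom
            naturality := fun g₁ g₂ φ => by
              have h := NatTrans.naturality_apply f φ.left.op g₂.hom
              have e : i.map φ.left ≫ g₂.hom = g₁.hom := CostructuredArrow.w φ
              refine Eq.trans ?_ (Category.comp_id _).symm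
              refine Eq.trans h.symm ?_
              exact congrArg (f.app (.op g₁.left)) e } }
    refine ⟨(i.denseAt Y).desc c, ?_⟩
    ext X x
    exact ((congrArg (· ≫ _) (Category.id_comp x)).symm).trans
      ((i.denseAt Y).fac c (CostructuredArrow.mk x))

variable (T : Monad A) (i : Θ ⥤ A)

/-- The canonical cocone exhibiting `T ⋙ N` as a left Kan extension, for `N` the nerve, is
colimiting as soon as weakly initial factorizations exist. -/
theorem nonempty_isPointwiseLeftKanExtension_arityNerve
    (H : ∀ (n : Θ) (X : A) (g : i.obj n ⟶ T.toFunctor.obj X),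
      ∃ φ : ArityFactorization T i g, ∀ ψ, φ.Step ψ) :
    Nonempty (Functor.LeftExtension.mk (L := i) (T.toFunctor ⋙ arityNerve i)
      (𝟙 (i ⋙ T.toFunctor ⋙ arityNerve i))).IsPointwiseLeftKanExtension := by
  choose φ hφ using H
  refine ⟨fun X => evaluationJointlyReflectsColimits _ fun n => ?_⟩
  -- An element `e` over `j` is itself a factorization of its image in `Hom(i n, TX)`. The step from
  -- the chosen factorization to it shows that a cocone depends only on that image.
  have key : ∀ (s : Cocone ((CostructuredArrow.proj i X ⋙ i ⋙ T.toFunctor ⋙ arityNerve i) ⋙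
      (evaluation _ _).obj n)) (j : CostructuredArrow i X)
      (e : i.obj n.unop ⟶ T.toFunctor.obj (i.obj j.left)),
      s.ι.app (CostructuredArrow.mk (φ n.unop X (e ≫ T.toFunctor.map j.hom)).f)
        (φ n.unop X (e ≫ T.toFunctor.map j.hom)).e = s.ι.app j e := by
    intro s j e
    obtain ⟨k, hk, hk'⟩ := hφ n.unop X (e ≫ T.toFunctor.map j.hom) ⟨j.left, e, j.hom, rfl⟩
    have hw := s.w (CostructuredArrow.homMk k hk' : CostructuredArrow.mk _ ⟶ j)
    rw [← hw]
    exact congrArg (s.ι.app j) hk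
  refine
    { desc := fun s => TypeCat.ofHom fun g : i.obj n.unop ⟶ T.toFunctor.obj X =>
        s.ι.app (CostructuredArrow.mk (φ n.unop X g).f) (φ n.unop X g).e
      fac := fun s j => ?_
      uniq := fun s m hm => ?_ }
  · ext e
    exact key s j e
  · ext g
    have h := ConcreteCategory.congr_hom (hm (CostructuredArrow.mk (φ n.unop X g).f))
      (φ n.unop X g).e
    refine Eq.trans ?_ h
    exact congrArg m (φ n.unop X g).fac.symm

/-- The colimits exhibiting the extension after the nerve are reflected by the nerve, which is fully
faithful by density; hence `T` is already a pointwise extension. -/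
theorem IsMonadWithArities.of_weaklyInitial (hfull : i.Full) (hfaithful : i.Faithful)
    (hdense : i.IsDense)
    (H : ∀ (n : Θ) (X : A) (g : i.obj n ⟶ T.toFunctor.obj X),
      ∃ φ : ArityFactorization T i g, ∀ ψ, φ.Step ψ) :
    IsMonadWithArities T i where
  full := hfull
  faithful := hfaithful
  dense := hdense
  isLeftKanExtension := by
    obtain ⟨h⟩ := nonempty_isPointwiseLeftKanExtension_arityNerve T i H
    have := arityNerve_full i
    have := arityNerve_faithful i
    have h' : (Functor.LeftExtension.mk (L := i) T.toFunctor
        (𝟙 (i ⋙ T.toFunctor))).IsPointwiseLeftKanExtension := fun X =>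
      isColimitOfReflects (arityNerve i) (IsColimit.ofIsoColimit (h X) (Cocone.ext (Iso.refl _) ?_))
    · exact h'.isLeftKanExtension
    · intro j
      ext n x
      exact congrArg (x ≫ ·) (Category.id_comp (T.toFunctor.map j.hom)).symm
  preserved := by
    obtain ⟨h⟩ := nonempty_isPointwiseLeftKanExtension_arityNerve T i H
    exact h.isLeftKanExtension

end Arities

/-! ### Pasting diagrams as shapes of 2-cells -/

namespace PD

variable {X Y : TwoGlob.{u}}

section Cells

variable {P : PD 2}

/-- The column of 2-cells which is the image of a column of a pasting diagram. -/
def colOf (g : P.toGlob ⟶ X) (i : Fin P.len) : Free.Column X :=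
  GPath.ofFn (P.height i) (fun j => TwoGlob.map1 g (⟨i, j⟩ : Cell1.{u} P))
    (fun j => TwoGlob.map2 g (⟨i, j⟩ : Cell2.{u} P))
    (fun j => TwoGlob.s₂_map g (⟨i, j⟩ : Cell2.{u} P))
    (fun j => TwoGlob.t₂_map g (⟨i, j⟩ : Cell2.{u} P))

/-- The 2-cell of the free 2-category on `X` which corresponds to a diagram in `X`. -/
def cellOf (g : P.toGlob ⟶ X) : Free.Cell2 X :=
  GPath.ofFn P.len (fun i => TwoGlob.map0 g (⟨i⟩ : Cell0.{u} P)) (colOf g)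
    (fun i => TwoGlob.s₁_map g (⟨i, 0⟩ : Cell1.{u} P))
    (fun i => TwoGlob.t₁_map g (⟨i, Fin.last _⟩ : Cell1.{u} P))

theorem colOf_comp (g : P.toGlob ⟶ X) (f : X ⟶ Y) (i : Fin P.len) :
    colOf (g ≫ f) i = Free.colMap f (colOf g i) :=
  (GPath.map_ofFn (TwoGlob.s₂_map f) (TwoGlob.t₂_map f)).symm

theorem cellOf_comp (g : P.toGlob ⟶ X) (f : X ⟶ Y) :
    cellOf (g ≫ f) = Free.cellMap f (cellOf g) := by
  refine GPath.ext_edges rfl ?_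
  change List.ofFn (colOf (g ≫ f)) = (List.ofFn (colOf g)).map (Free.colMap f)
  rw [List.map_ofFn]
  exact congrArg List.ofFn (funext (colOf_comp g f))

/-- Every cell of `P` is visible: 0-cells as vertices of the horizontal path, 1-cells as vertices of
columns, 2-cells as edges of columns. -/
theorem cellOf_injective {g g' : P.toGlob ⟶ X} (h : cellOf g = cellOf g') : g = g' := by
  obtain ⟨h₀, h₁⟩ := GPath.ofFn_injective h
  have h₂ := fun i => GPath.ofFn_injective (congrFun h₁ i)
  exact TwoGlob.hom_ext (fun x => congrFun h₀ x.pos) (fun x => congrFun (h₂ x.col).1 x.pos)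
    (fun x => congrFun (h₂ x.col).2 x.pos)

variable (P) in
/-- The list of the heights of the columns of a 2-pasting diagram. -/
def heights : List ℕ := List.ofFn P.height

/-- The list of the heights of the columns of a 2-cell of a free 2-category. -/
def cellHeights (α : Free.Cell2 X) : List ℕ := α.edges.map fun c => c.edges.length

theorem exists_heights_eq (l : List ℕ) : ∃ P, heights P = l := by
  -- `PD 2` unfolds to lists of lists of units, where a number is encoded as a list of that length.
  let P : List (List Unit) := l.map fun n => List.replicate n ()
  refine ⟨P, ?_⟩
  have h : List.ofFn (List.length ∘ P.get) = P.map List.length := by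
    rw [← List.map_ofFn, List.ofFn_get]
  refine h.trans ((list_map_map _ _ id l fun n => ?_).trans (List.map_id l))
  exact List.length_replicate

theorem cellHeights_cellMap (f : X ⟶ Y) (α : Free.Cell2 X) :
    cellHeights (Free.cellMap f α) = cellHeights α :=
  list_map_map (Free.colMap f) _ _ α.edges fun _ => List.length_map _

theorem cellHeights_cellOf (g : P.toGlob ⟶ X) : cellHeights (cellOf g) = heights P := by
  change (List.ofFn (colOf g)).map _ = _
  rw [List.map_ofFn]
  exact congrArg List.ofFn (funext fun i => List.length_ofFn)

theorem exists_cellOf (α : Free.Cell2 X) (h : cellHeights α = heights P) :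
    ∃ g : P.toGlob ⟶ X, cellOf g = α := by
  have hlen : α.edges.length = P.len := by
    have := congrArg List.length h
    rwa [cellHeights, heights, List.length_map, List.length_ofFn] at this
  obtain ⟨v, e, hs, ht, rfl⟩ := α.exists_ofFn hlen
  have hh : ∀ i, (e i).edges.length = P.height i := by
    change (List.ofFn e).map _ = _ at h
    rw [List.map_ofFn] at h
    exact congrFun (List.ofFn_injective h)
  choose w x hws hwt hx using fun i => (e i).exists_ofFn (hh i)
  -- The path condition concerns only the first 1-cell of a column; globularity carries it along the
  -- column. For targets below, the condition at the last 1-cell is first moved to the first one.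
  have hs₀ : ∀ i j, X.s₁ (w i j) = v i.castSucc := fun i j => by
    induction j using Fin.induction with
    | zero => rw [← hs, ← hx]; rfl
    | succ j ih => rw [← hwt, X.s₁_t₂, hws, ih]
  have ht₀ : ∀ i j, X.t₁ (w i j) = v i.succ := fun i j => by
    induction j using Fin.induction with
    | zero => rw [← ht, ← Free.Column.t_tgt, ← hx]; rfl
    | succ j ih => rw [← hwt, ← X.t₁_s₂, hws, ih]
  refine ⟨TwoGlob.homMk (fun a : Cell0.{u} P => v a.pos) (fun a : Cell1.{u} P => w a.col a.pos)
    (fun a : Cell2.{u} P => x a.col a.pos) (fun a => hs₀ a.col a.pos) (fun a => ht₀ a.col a.pos)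
    (fun a => hws a.col a.pos) (fun a => hwt a.col a.pos), ?_⟩
  exact GPath.ext_edges rfl (congrArg List.ofFn (funext hx))

end Cells

/-! ### The generic factorization -/

/-- A diagram in the free 2-category on `X` factors through the free 2-category on a pasting
diagram. -/
theorem exists_generic_factorization (P : PD 2) (g : P.toGlob ⟶ Free.glob X) :
    ∃ (F : PD 2) (e : P.toGlob ⟶ Free.glob F.toGlob) (f : F.toGlob ⟶ X), e ≫ Free.globMap f = g ∧
      ∀ (Q : PD 2) (e' : P.toGlob ⟶ Free.glob Q.toGlob) (f' : Q.toGlob ⟶ X),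
        e' ≫ Free.globMap f' = g →
        ∃ k : F.toGlob ⟶ Q.toGlob, e ≫ Free.globMap k = e' ∧ k ≫ f' = f := by
  -- `F` is the shape of the composite of `g`, and `f` is that composite read as a diagram in `X`.
  obtain ⟨F, hF⟩ := exists_heights_eq (cellHeights (Free.flatten X (cellOf g)))
  obtain ⟨f, hf⟩ := exists_cellOf _ hF.symm
  have hf' : Free.cellMap f (cellOf (𝟙 F.toGlob)) = Free.flatten X (cellOf g) := by
    rw [← cellOf_comp, Category.id_comp, hf]
  -- Cartesianness lifts `g` to a 2-cell over `F` that composes to the tautological one; morphisms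
  -- preserve heights, so it still has shape `P`.
  obtain ⟨ε, hε, hε'⟩ := Free.exists_flatten f (cellOf g) (cellOf (𝟙 F.toGlob)) hf'
  obtain ⟨e, rfl⟩ := exists_cellOf (P := P) ε (by
    rw [← cellHeights_cellMap (Free.globMap f), hε, cellHeights_cellOf])
  refine ⟨F, e, f, cellOf_injective ((cellOf_comp _ _).trans hε), fun Q e' f' h => ?_⟩
  have hq : Free.cellMap f' (Free.flatten _ (cellOf e')) = Free.flatten X (cellOf g) := by
    rw [← Free.flatten_map, ← cellOf_comp, h]
  -- The composite of `e'` lies over the composite of `g`, so it too has shape `F`.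
  obtain ⟨k, hk⟩ := exists_cellOf (P := F) (Free.flatten _ (cellOf e')) (by
    rw [← cellHeights_cellMap f', hq, hF])
  have hkf : k ≫ f' = f := cellOf_injective (by rw [cellOf_comp, hk, hq, hf])
  -- `e` followed by the image of `k` and `e'` both lie over `g` and have the same composite.
  refine ⟨k, cellOf_injective (Free.flatten_injective f' _ _ ?_ ?_), hkf⟩
  · rw [← cellOf_comp, ← cellOf_comp, Category.assoc, ← Free.globMap_comp, hkf, h, cellOf_comp, hε]
  · rw [cellOf_comp, Free.flatten_map, hε', ← cellOf_comp, Category.id_comp, hk]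

/-! ### Full faithfulness of the realization -/

theorem realization_faithful : PD.realization.{u}.Faithful where
  map_injective {P Q f g} h := by
    have h₀ : ∀ x : Cell0.{u} P, TwoGlob.map0 f.toGlob x = TwoGlob.map0 g.toGlob x := fun x =>
      congrArg (fun φ : P.toGlob ⟶ Q.toGlob => TwoGlob.map0 φ x) h
    have h₁ : ∀ x : Cell1.{u} P, TwoGlob.map1 f.toGlob x = TwoGlob.map1 g.toGlob x := fun x =>
      congrArg (fun φ : P.toGlob ⟶ Q.toGlob => TwoGlob.map1 φ x) h
    refine Hom.ext ?_ (funext fun i => ?_)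
    · exact congrArg (fun x : Cell0.{u} Q => x.pos.val) (h₀ ⟨0⟩)
    · exact congrArg (fun x : Cell1.{u} Q => x.pos.val) (h₁ ⟨i, 0⟩)

/-- Source and target of a cell are adjacent both in `P` and in `Q`, so positions are translated:
horizontally by the image of the 0-cell `0`, vertically by the image of the first 1-cell of each
column. -/
theorem realization_full : PD.realization.{u}.Full where
  map_surjective {P Q} h := by
    let h₀ : Cell0.{u} P → Cell0.{u} Q := TwoGlob.map0 h
    let h₁ : Cell1.{u} P → Cell1.{u} Q := TwoGlob.map1 h
    let h₂ : Cell2.{u} P → Cell2.{u} Q := TwoGlob.map2 h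
    have hs₁ : ∀ x, (h₁ x).col.castSucc = (h₀ ⟨x.col.castSucc⟩).pos := fun x =>
      congrArg Cell0.pos (TwoGlob.s₁_map h x)
    have ht₁ : ∀ x, (h₁ x).col.succ = (h₀ ⟨x.col.succ⟩).pos := fun x =>
      congrArg Cell0.pos (TwoGlob.t₁_map h x)
    have hs₂ : ∀ x, (⟨(h₂ x).col, (h₂ x).pos.castSucc⟩ : Cell1.{u} Q) =
      h₁ ⟨x.col, x.pos.castSucc⟩ := fun x => TwoGlob.s₂_map h x
    have ht₂ : ∀ x, (⟨(h₂ x).col, (h₂ x).pos.succ⟩ : Cell1.{u} Q) =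
      h₁ ⟨x.col, x.pos.succ⟩ := fun x => TwoGlob.t₂_map h x
    have e₀ : ∀ i, (h₀ ⟨i⟩).pos.val = (h₀ ⟨0⟩).pos.val + i.val := fun i => by
      induction i using Fin.induction with
      | zero => rfl
      | succ i ih =>
        have a := congrArg Fin.val (hs₁ ⟨i, 0⟩)
        have b := congrArg Fin.val (ht₁ ⟨i, 0⟩)
        simp only [Fin.val_castSucc, Fin.val_succ] at a b ih ⊢
        omega
    have ec : ∀ x, (h₁ x).col.val = (h₀ ⟨0⟩).pos.val + x.col.val := fun x =>
      (congrArg Fin.val (hs₁ x)).trans (e₀ _)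
    -- Only values are compared, since the type of the position depends on the column of the image.
    have e₁ : ∀ i j, (h₁ ⟨i, j⟩).pos.val = (h₁ ⟨i, 0⟩).pos.val + j.val := fun i j => by
      induction j using Fin.induction with
      | zero => rfl
      | succ j ih =>
        have a := congrArg (fun x : Cell1.{u} Q => x.pos.val) (hs₂ ⟨i, j⟩)
        have b := congrArg (fun x : Cell1.{u} Q => x.pos.val) (ht₂ ⟨i, j⟩)
        simp only [Fin.val_castSucc, Fin.val_succ] at a b ih ⊢
        omega
    have e₂ : ∀ i j, (h₂ ⟨i, j⟩).pos.val = (h₁ ⟨i, 0⟩).pos.val + j.val := fun i j =>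
      (congrArg (fun x : Cell1.{u} Q => x.pos.val) (hs₂ ⟨i, j⟩)).trans (e₁ i j.castSucc)
    have ec₂ : ∀ x, (h₂ x).col.val = (h₀ ⟨0⟩).pos.val + x.col.val := fun x =>
      (congrArg (fun x : Cell1.{u} Q => x.col.val) (hs₂ x)).trans (ec _)
    let k : Hom P Q :=
      { shift := (h₀ ⟨0⟩).pos.val
        shift_le := by
          have := e₀ (Fin.last _)
          rw [Fin.val_last] at this
          have := (h₀ ⟨Fin.last _⟩).pos.isLt
          omega
        vshift := fun i => (h₁ ⟨i, 0⟩).pos.val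
        vshift_le := fun i => by
          have a := e₁ i (Fin.last _)
          rw [Fin.val_last] at a
          have b := (h₁ ⟨i, Fin.last _⟩).pos.isLt
          refine le_trans (b := Q.height (h₁ ⟨i, Fin.last _⟩).col) (by omega) (le_of_eq ?_)
          exact congrArg Q.height (Fin.ext (ec ⟨i, Fin.last _⟩)) }
    exact ⟨k, TwoGlob.hom_ext (fun x => Cell0.ext (Fin.ext (e₀ x.pos).symm))
      (fun x => Cell1.ext_val (ec x).symm (e₁ x.col x.pos).symm)
      (fun x => Cell2.ext_val (ec₂ x).symm (e₂ x.col x.pos).symm)⟩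

end PD

/-! ### A density criterion -/

section Density

open Limits

/-- A full functor to a category of presheaves is dense if its values include objects with the
universal property of the representable presheaves. -/
theorem isDense_of_universal_elements {Θ : Type w} [SmallCategory Θ] {C : Type v} [Category.{w'} C]
    (i : Θ ⥤ Cᵒᵖ ⥤ Type u) [i.Full] (D : Cᵒᵖ → Θ) (x : ∀ d, (i.obj (D d)).obj d)
    (hx : ∀ (Y : Cᵒᵖ ⥤ Type u) (d : Cᵒᵖ) (y : Y.obj d), ∃ g : i.obj (D d) ⟶ Y, g.app d (x d) = y)
    (hx' : ∀ (Y : Cᵒᵖ ⥤ Type u) (d : Cᵒᵖ) (g g' : i.obj (D d) ⟶ Y),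
      g.app d (x d) = g'.app d (x d) → g = g') : i.IsDense where
  isDenseAt Y := by
    choose γ hγ using hx Y
    -- Each element `a` is classified by a morphism `i.map k`, using fullness; so `k` is a morphism
    -- over `Y`, and the cocone is determined by its values at universal elements.
    have key : ∀ (s : Cocone (CostructuredArrow.proj i Y ⋙ i)) (j : CostructuredArrow i Y) (d : Cᵒᵖ)
        (a : (i.obj j.left).obj d),
        (s.ι.app (CostructuredArrow.mk (γ d (j.hom.app d a)))).app d (x d) =
          (s.ι.app j).app d a := by
      intro s j d a
      obtain ⟨k, hk⟩ := hx _ d a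
      obtain ⟨k, rfl⟩ := i.map_surjective k
      have e : i.map k ≫ j.hom = γ d (j.hom.app d a) := by
        refine hx' _ _ _ _ ?_
        rw [hγ]
        exact congrArg (j.hom.app d) hk
      have hw := s.w (CostructuredArrow.homMk k e : CostructuredArrow.mk _ ⟶ j)
      rw [← hw]
      exact congrArg ((s.ι.app j).app d) hk
    refine ⟨
      { desc := fun s =>
          { app := fun d => TypeCat.ofHom fun y =>
              (s.ι.app (CostructuredArrow.mk (γ d y))).app d (x d)
            naturality := fun d d' f => ?_ }
        fac := fun s j => ?_
        uniq := fun s m hm => ?_ }⟩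
    · ext y
      -- Naturality comes from `key` at the restriction along `f` of the universal element.
      have h := key s (CostructuredArrow.mk (γ d y)) d' ((i.obj (D d)).map f (x d))
      have e : (γ d y).app d' ((i.obj (D d)).map f (x d)) = Y.map f y := by
        exact (NatTrans.naturality_apply (γ d y) f (x d)).trans (congrArg (Y.map f) (hγ d y))
      have e' := NatTrans.naturality_apply (s.ι.app (CostructuredArrow.mk (γ d y))) f (x d)
      refine Eq.trans ?_ (h.trans e')
      exact congrArg (fun z : Y.obj d' =>
        (show s.pt.obj d' from (s.ι.app (CostructuredArrow.mk (γ d' z))).app d' (x d'))) e.symm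
    · ext d a
      exact key s j d a
    · ext d y
      have h := hm (CostructuredArrow.mk (γ d y))
      have h' := ConcreteCategory.congr_hom (NatTrans.congr_app h d) (x d)
      refine Eq.trans ?_ h'
      exact congrArg (m.app d) (hγ d y).symm

end Density

/-! ### Disks and the density of the realization -/

namespace PD

/-- The pasting diagram which pictures a representable 2-globular set. -/
def disk : Globe2 → PD 2
  | .d0 => ([] : List (List Unit))
  | .d1 => ([[]] : List (List Unit))
  | .d2 => ([[()]] : List (List Unit))

/-- The universal 0-cell. -/
def top0 : Cell0.{u} (disk .d0) := ⟨0⟩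

/-- The universal 1-cell. -/
def top1 : Cell1.{u} (disk .d1) := ⟨⟨0, Nat.zero_lt_one⟩, 0⟩

/-- The universal 2-cell. -/
def top2 : Cell2.{u} (disk .d2) := ⟨⟨0, Nat.zero_lt_one⟩, ⟨0, Nat.zero_lt_one⟩⟩

variable {Y : TwoGlob.{u}}

/-- This and its two analogues let `exists_cellOf` and `cellOf_injective` yield the Yoneda property
of the disks. -/
theorem cellOf_disk0 (g : (disk .d0).toGlob ⟶ Y) :
    cellOf g = GPath.nil _ _ (TwoGlob.map0 g top0.{u}) :=
  GPath.ext_edges rfl rfl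

theorem cellOf_disk1 (g : (disk .d1).toGlob ⟶ Y) :
    cellOf g = GPath.single _ _ (GPath.nil _ _ (TwoGlob.map1 g top1.{u})) :=
  GPath.ext_edges (TwoGlob.s₁_map g top1.{u}).symm
    (congrArg (fun c => [c]) (GPath.ext_edges rfl rfl :
      colOf g ⟨0, Nat.zero_lt_one⟩ = GPath.nil _ _ (TwoGlob.map1 g top1.{u})))

theorem cellOf_disk2 (g : (disk .d2).toGlob ⟶ Y) :
    cellOf g = GPath.single _ _ (GPath.single _ _ (TwoGlob.map2 g top2.{u})) := by
  have h := (TwoGlob.s₂_map g top2.{u}).symm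
  exact GPath.ext_edges ((TwoGlob.s₁_map g _).symm.trans (congrArg Y.s₁ h))
    (congrArg (fun c => [c]) (GPath.ext_edges h rfl :
      colOf g ⟨0, Nat.zero_lt_one⟩ = GPath.single _ _ (TwoGlob.map2 g top2.{u})))

theorem exists_disk0 (y : Y.C0) :
    ∃ g : (disk .d0).toGlob ⟶ Y, TwoGlob.map0 g top0.{u} = y := by
  obtain ⟨g, hg⟩ := exists_cellOf (P := disk .d0) (X := Y) (GPath.nil _ _ y) rfl
  exact ⟨g, congrArg GPath.src ((cellOf_disk0 g).symm.trans hg)⟩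

theorem exists_disk1 (y : Y.C1) :
    ∃ g : (disk .d1).toGlob ⟶ Y, TwoGlob.map1 g top1.{u} = y := by
  obtain ⟨g, hg⟩ := exists_cellOf (P := disk .d1) (X := Y)
    (GPath.single _ _ (GPath.nil _ _ y)) rfl
  have h := congrArg GPath.edges ((cellOf_disk1 g).symm.trans hg)
  exact ⟨g, congrArg GPath.src (List.cons.inj h).1⟩

theorem exists_disk2 (y : Y.C2) :
    ∃ g : (disk .d2).toGlob ⟶ Y, TwoGlob.map2 g top2.{u} = y := by
  obtain ⟨g, hg⟩ := exists_cellOf (P := disk .d2) (X := Y)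
    (GPath.single _ _ (GPath.single _ _ y)) rfl
  have h := congrArg GPath.edges ((cellOf_disk2 g).symm.trans hg)
  exact ⟨g, (List.cons.inj (congrArg GPath.edges (List.cons.inj h).1)).1⟩

theorem realization_dense : PD.realization.{u}.IsDense := by
  have := realization_full.{u}
  refine isDense_of_universal_elements _ (fun d => disk d.unop)
    (fun d => match d with
      | ⟨.d0⟩ => top0.{u}
      | ⟨.d1⟩ => top1.{u}
      | ⟨.d2⟩ => top2.{u}) (fun Y d y => ?_) (fun Y d g g' h => ?_)
  · obtain ⟨_ | _ | _⟩ := d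
    · exact exists_disk0 y
    · exact exists_disk1 y
    · exact exists_disk2 y
  · obtain ⟨_ | _ | _⟩ := d
    · exact cellOf_injective ((cellOf_disk0 g).trans
        ((congrArg (GPath.nil _ _) h).trans (cellOf_disk0 g').symm))
    · exact cellOf_injective ((cellOf_disk1 g).trans
        ((congrArg (fun y => GPath.single _ _ (GPath.nil (TwoGlob.s₂ Y) (TwoGlob.t₂ Y) y)) h).trans
          (cellOf_disk1 g').symm))
    · exact cellOf_injective ((cellOf_disk2 g).trans
        ((congrArg (fun y => GPath.single _ _ (GPath.single (TwoGlob.s₂ Y) (TwoGlob.t₂ Y) y)) h).trans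
          (cellOf_disk2 g').symm))

end PD

/-! ### Conclusion -/

/-- Every morphism from a pasting diagram to a free 2-category has a factorization with a morphism
to any other one. -/
theorem exists_weaklyInitial_factorization (P : PD 2) (X : TwoGlob.{u})
    (g : PD.realization.{u}.obj P ⟶ freeTwoCatMonad.{u}.toFunctor.obj X) :
    ∃ φ : ArityFactorization freeTwoCatMonad.{u} PD.realization.{u} g, ∀ ψ, φ.Step ψ := by
  obtain ⟨F, e, f, h, H⟩ := PD.exists_generic_factorization P g
  refine ⟨⟨F, e, f, (congrArg (e ≫ ·) (Free.monad_map f)).trans h⟩, fun ψ => ?_⟩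
  obtain ⟨k, hk, hk'⟩ := H ψ.p ψ.e ψ.f ((congrArg (ψ.e ≫ ·) (Free.monad_map ψ.f)).symm.trans ψ.fac)
  have := PD.realization_full.{u}
  -- Fullness turns the morphism of 2-globular sets into one of `pd(2)`, as a step requires.
  obtain ⟨k, rfl⟩ := PD.realization.{u}.map_surjective k
  exact ⟨k, (congrArg (e ≫ ·) (Free.monad_map _)).trans hk, hk'⟩

end TwoArities

open TwoArities
theorem mainTheorem2 :
    IsMonadWithArities freeTwoCatMonad.{u} PD.realization.{u} ∧
    ∀ (P : PD 2) (X : TwoGlob.{u})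
      (g : PD.realization.{u}.obj P ⟶ freeTwoCatMonad.{u}.toFunctor.obj X),
      Nonempty (ArityFactorization freeTwoCatMonad.{u} PD.realization.{u} g) ∧
      ∀ φ ψ : ArityFactorization freeTwoCatMonad.{u} PD.realization.{u} g,
        Relation.EqvGen ArityFactorization.Step φ ψ := by
  refine ⟨IsMonadWithArities.of_weaklyInitial _ _ PD.realization_full PD.realization_faithful
    PD.realization_dense exists_weaklyInitial_factorization, fun P X g => ?_⟩
  obtain ⟨χ, hχ⟩ := exists_weaklyInitial_factorization P X g
  exact ⟨⟨χ⟩, fun φ ψ => (Relation.EqvGen.rel _ _ (hχ φ)).symm.trans _ _ _ (.rel _ _ (hχ ψ))⟩
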